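/- All vector spaces are over a field $K$ of characteristic $0$; a homogeneous element in an exponent of $-1$ stands for its degree, and all identities below are for homogeneous elements. $\varepsilon(\sigma)$ is the Koszul sign, $v_1\odot\cdots\odot v_n=\varepsilon(\sigma)\,v_{\sigma(1)}\odot\cdots\odot v_{\sigma(n)}$ in the graded symmetric algebra, and $\mathbb S_{(i_1,\dots,i_k)}$ is the set of $(i_1,\dots,i_k)$-shuffles (empty if some $i_j<0$). A symmetric graded Lie algebra (sgLa) is a $\mathbb Z$-graded vector space $\mathfrak g$ with a bilinear bracket of degree $1$ such that $[x,y]=(-1)^{xy}[y,x]$ and $[x,[y,z]]=(-1)^{x+1}[[x,y],z]+(-1)^{(x+1)(y+1)}[y,[x,z]]$. A derivation of degree $n$ is a linear map $D$ of degree $n$ with $D[x,y]=(-1)^n[Dx,y]+(-1)^{n(x+1)}[x,Dy]$. An action of $(\mathfrak g,[\cdot,\cdot]_{\mathfrak g})$ on $(\mathfrak h,[\cdot,\cdot]_{\mathfrak h})$ is a linear map $\rho:\mathfrak g\to\mathrm{Der}(\mathfrak h)$ of degree $1$ with $\rho([x,y]_{\mathfrak g})=(-1)^{x+1}\big(\rho(x)\rho(y)-(-1)^{(x+1)(y+1)}\rho(y)\rho(x)\big)$.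 A homotopy $\mathcal O$-operator of weight $\lambda$ on $\mathfrak g$ with respect to $\rho$ is a family $T=\sum_{i\ge 0}T_i$ of graded symmetric multilinear maps $T_i:\mathfrak h^{\otimes i}\to\mathfrak g$ of degree $0$ such that for all $p\ge 0$ and $v_1,\dots,v_p\in\mathfrak h$ $$\sum_{1\le i<j\le p}(-1)^{v_i(v_1+\cdots+v_{i-1})+v_j(v_1+\cdots+v_{j-1})+v_iv_j}\,T_{p-1}(\lambda[v_i,v_j]_{\mathfrak h},v_1,\dots,\hat v_i,\dots,\hat v_j,\dots,v_p)$$ $$+\sum_{l=0}^{p-1}\ \sum_{\sigma\in\mathbb S_{(l,1,p-l-1)}}\varepsilon(\sigma)\,T_{p-l}\big(\rho(T_l(v_{\sigma(1)},\dots,v_{\sigma(l)}))v_{\sigma(l+1)},v_{\sigma(l+2)},\dots,v_{\sigma(p)}\big)$$ $$=\frac12\sum_{i=0}^{p}\ \sum_{\sigma\in\mathbb S_{(i,p-i)}}\varepsilon(\sigma)\,[T_i(v_{\sigma(1)},\dots,v_{\sigma(i)}),T_{p-i}(v_{\sigma(i+1)},\dots,v_{\sigma(p)})]_{\mathfrak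 g}.$$ An operator homotopy post-Lie algebra is an sgLa $(\mathfrak h,[\cdot,\cdot]_{\mathfrak h})$ with multilinear maps $\vartheta_k:\mathfrak h^{\otimes k}\to\mathfrak h$ ($k\ge1$) of degree $1$ such that for all $n\ge 1$: (i) $\vartheta_n$ is graded symmetric in its first $n-1$ arguments; (ii) $\vartheta_n(x_1,\dots,x_{n-1},\cdot)$ is a derivation of $\mathfrak h$ of degree $x_1+\cdots+x_{n-1}+1$; (iii) $$\sum_{\substack{i+j=n+1\\ i\ge1,\,j\ge2}}\ \sum_{\sigma\in\mathbb S_{(i-1,1,j-2)}}\varepsilon(\sigma)\,\vartheta_j(\vartheta_i(x_{\sigma(1)},\dots,x_{\sigma(i)}),x_{\sigma(i+1)},\dots,x_{\sigma(n-1)},x_n)$$ $$+\sum_{\substack{i+j=n+1\\ i,j\ge1}}\ \sum_{\sigma\in\mathbb S_{(j-1,i-1)}}(-1)^{x_{\sigma(1)}+\cdots+x_{\sigma(j-1)}}\varepsilon(\sigma)\,\vartheta_j(x_{\sigma(1)},\dots,x_{\sigma(j-1)},\vartheta_i(x_{\sigma(j)},\dots,x_{\sigma(n-1)},x_n))$$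 $$=-\sum_{1\le i<j\le n-1}(-1)^{x_i(x_1+\cdots+x_{i-1})+x_j(x_1+\cdots+x_{j-1})+x_ix_j}\,\vartheta_{n-1}([x_i,x_j]_{\mathfrak h},x_1,\dots,\hat x_i,\dots,\hat x_j,\dots,x_n).$$ An $L_\infty$-algebra is a graded vector space $V$ with graded symmetric multilinear maps $l_k:V^{\otimes k}\to V$ ($k\ge 1$) of degree $1$ such that $\sum_{j=1}^{n}\sum_{\sigma\in\mathbb S_{(j,n-j)}}\varepsilon(\sigma)\,l_{n-j+1}(l_j(v_{\sigma(1)},\dots,v_{\sigma(j)}),v_{\sigma(j+1)},\dots,v_{\sigma(n)})=0$ for all $n\ge 1$. A curved $L_\infty$-algebra homomorphism from an $L_\infty$-algebra $(V,\{l_k\})$ to an sgLa $(V',[\cdot,\cdot]')$ is a family of graded symmetric multilinear maps $f_k:V^{\otimes k}\to V'$ ($k\ge 0$) of degree $0$ with, for all $n\ge 0$, $$\sum_{i=1}^n\sum_{\sigma\in\mathbb S_{(i,n-i)}}\varepsilon(\sigma)\,f_{n-i+1}(l_i(v_{\sigma(1)},\dots,v_{\sigma(i)}),v_{\sigma(i+1)},\dots,v_{\sigma(n)})$$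 $$=\frac12\sum_{i=0}^n\sum_{\sigma\in\mathbb S_{(i,n-i)}}\varepsilon(\sigma)\,[f_i(v_{\sigma(1)},\dots,v_{\sigma(i)}),f_{n-i}(v_{\sigma(i+1)},\dots,v_{\sigma(n)})]'.$$ **Theorem.** Let $\rho$ be an action of an sgLa $(\mathfrak g,[\cdot,\cdot]_{\mathfrak g})$ on an sgLa $(\mathfrak h,[\cdot,\cdot]_{\mathfrak h})$, and let $T=\sum_{i\ge0}T_i$ be a homotopy $\mathcal O$-operator of weight $1$ on $\mathfrak g$ with respect to $\rho$. Then $(\mathfrak h,[\cdot,\cdot]_{\mathfrak h})$ with $\vartheta_k(v_1,\dots,v_k):=\rho(T_{k-1}(v_1,\dots,v_{k-1}))v_k$ ($k\ge1$) is an operator homotopy post-Lie algebra; $(\mathfrak h,\{l_k\}_{k\ge1})$ with $l_1=\vartheta_1$, $l_2(x,y)=\vartheta_2(x,y)+(-1)^{xy}\vartheta_2(y,x)+[x,y]_{\mathfrak h}$ and $l_k(x_1,\dots,x_k)=\sum_{i=1}^k(-1)^{x_i(x_{i+1}+\cdots+x_k)}\vartheta_k(x_1,\dots,\hat x_i,\dots,x_k,x_i)$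 for $k\ge3$ is an $L_\infty$-algebra; and $T$ is a curved $L_\infty$-algebra homomorphism from $(\mathfrak h,\{l_k\}_{k\ge1})$ to $(\mathfrak g,[\cdot,\cdot]_{\mathfrak g})$. -/

import Mathlib

/-!
A `ℤ`-graded vector space over `K` is a `K`-module `V` with a family `𝒱 : ℤ → Submodule K V` of
homogeneous components and `[DirectSum.Decomposition 𝒱]`. A sequence `f₀, f₁, f₂, …` with
`fₙ : V^{⊗ n} → W` is a family of multilinear maps indexed by the arity.
-/

namespace HomotopyO

open Finset

section Combinatorics

/-- The Koszul sign `ε(σ; v₁, …, vₙ)` for homogeneous `v₁, …, vₙ` of degrees `d`, defined by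
`v₁ ⊙ ⋯ ⊙ vₙ = ε(σ) v_{σ(1)} ⊙ ⋯ ⊙ v_{σ(n)}`: a factor `(-1)^{v v'}` for every pair `v, v'`
that is put in the opposite order. -/
def koszulSign {n : ℕ} (d : Fin n → ℤ) (σ : Equiv.Perm (Fin n)) : ℤˣ :=
  ∏ p ∈ (univ : Finset (Fin n × Fin n)).filter (fun p => p.1 < p.2 ∧ σ p.2 < σ p.1),
    (d (σ p.1) * d (σ p.2)).negOnePow

open Classical in
/-- The set of `(i, n - i)`-shuffles. -/
noncomputable def shuffles (n i : ℕ) : Finset (Equiv.Perm (Fin n)) :=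
  univ.filter fun σ =>
    StrictMonoOn σ {a : Fin n | (a : ℕ) < i} ∧ StrictMonoOn σ {a : Fin n | i ≤ (a : ℕ)}

open Classical in
/-- The set of `(i, 1, n - i - 1)`-shuffles. -/
noncomputable def shufflesOne (n i : ℕ) : Finset (Equiv.Perm (Fin n)) :=
  univ.filter fun σ =>
    StrictMonoOn σ {a : Fin n | (a : ℕ) < i} ∧ StrictMonoOn σ {a : Fin n | i + 1 ≤ (a : ℕ)}

/-- The `m` consecutive entries of `v` that come after the first `s` ones. -/
def block {α : Type*} {n : ℕ} (v : Fin n → α) (s m : ℕ) (h : s + m ≤ n) : Fin m → α :=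
  fun a => v ⟨s + a, by have := a.isLt; omega⟩

/-- `(v₁, …, v̂ᵢ, …, v̂ⱼ, …, vₙ)` for `i < j`. -/
def omitTwo {α : Type*} {n : ℕ} (v : Fin n → α) (i j : Fin n) : Fin (n - 2) → α :=
  fun a => v ⟨if (a : ℕ) < i then a else if (a : ℕ) + 1 < j then a + 1 else a + 2, by
    have := a.isLt
    split_ifs <;> omega⟩

/-- The sign `(-1)^{vᵢ(v₁+⋯+v_{i-1}) + vⱼ(v₁+⋯+v_{j-1}) + vᵢvⱼ}`. -/
def pairSign {n : ℕ} (d : Fin n → ℤ) (i j : Fin n) : ℤˣ :=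
  (d i * (∑ a ∈ Iio i, d a) + d j * (∑ a ∈ Iio j, d a) + d i * d j).negOnePow

end Combinatorics

section Maps

/-- A multilinear map between graded vector spaces is of degree `e`. -/
def HasDegree {K V W : Type*} [Field K] [AddCommGroup V] [Module K V] [AddCommGroup W]
    [Module K W] (𝒱 : ℤ → Submodule K V) (𝒲 : ℤ → Submodule K W) {n : ℕ}
    (f : MultilinearMap K (fun _ : Fin n => V) W) (e : ℤ) : Prop :=
  ∀ (d : Fin n → ℤ) (v : Fin n → V), (∀ a, v a ∈ 𝒱 (d a)) → f v ∈ 𝒲 ((∑ a, d a) + e)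

/-- A multilinear map is graded symmetric, that is, it is a linear map on `Sⁿ(V)`. -/
def IsGradedSymm {K V W : Type*} [Field K] [AddCommGroup V] [Module K V] [AddCommGroup W]
    [Module K W] (𝒱 : ℤ → Submodule K V) {n : ℕ}
    (f : MultilinearMap K (fun _ : Fin n => V) W) : Prop :=
  ∀ (d : Fin n → ℤ) (v : Fin n → V), (∀ a, v a ∈ 𝒱 (d a)) →
    ∀ σ : Equiv.Perm (Fin n), f (v ∘ σ) = koszulSign d σ • f v

end Maps

section Structures

/-- A symmetric graded Lie algebra. -/
structure SGLA (K : Type*) {V : Type*} [Field K] [AddCommGroup V] [Module K V]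
    (𝒱 : ℤ → Submodule K V) where
  bracket : V →ₗ[K] V →ₗ[K] V
  bracket_mem : ∀ (i j : ℤ) (x y : V), x ∈ 𝒱 i → y ∈ 𝒱 j → bracket x y ∈ 𝒱 (i + j + 1)
  graded_symm : ∀ (i j : ℤ) (x y : V), x ∈ 𝒱 i → y ∈ 𝒱 j →
    bracket x y = (i * j).negOnePow • bracket y x
  leibniz : ∀ (i j k : ℤ) (x y z : V), x ∈ 𝒱 i → y ∈ 𝒱 j → z ∈ 𝒱 k →
    bracket x (bracket y z) = (i + 1).negOnePow • bracket (bracket x y) z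
      + ((i + 1) * (j + 1)).negOnePow • bracket y (bracket x z)

/-- `D` is a derivation of degree `n` on a symmetric graded Lie algebra. -/
structure IsDerivation {K V : Type*} [Field K] [AddCommGroup V] [Module K V]
    {𝒱 : ℤ → Submodule K V} (L : SGLA K 𝒱) (n : ℤ) (D : Module.End K V) : Prop where
  map_mem : ∀ (i : ℤ) (x : V), x ∈ 𝒱 i → D x ∈ 𝒱 (i + n)
  map_bracket : ∀ (i j : ℤ) (x y : V), x ∈ 𝒱 i → y ∈ 𝒱 j →
    D (L.bracket x y) = n.negOnePow • L.bracket (D x) y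
      + (n * (i + 1)).negOnePow • L.bracket x (D y)

/-- An action of the symmetric graded Lie algebra `𝔤` on the symmetric graded Lie algebra `𝔥`: a
linear map `ρ : 𝔤 → Der(𝔥)` of degree `1` such that `s⁻¹ ∘ ρ` respects the brackets, where
`[s⁻¹D, s⁻¹D'] = (-1)^m s⁻¹(D ∘ D' - (-1)^{m n} D' ∘ D)` for `D, D'` of degrees `m, n`. -/
structure Action {K G H : Type*} [Field K] [AddCommGroup G] [Module K G] [AddCommGroup H]
    [Module K H] {𝒢 : ℤ → Submodule K G} {ℋ : ℤ → Submodule K H}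
    (𝔤 : SGLA K 𝒢) (𝔥 : SGLA K ℋ) where
  ρ : G →ₗ[K] Module.End K H
  isDerivation : ∀ (i : ℤ) (x : G), x ∈ 𝒢 i → IsDerivation 𝔥 (i + 1) (ρ x)
  map_bracket : ∀ (i j : ℤ) (x y : G), x ∈ 𝒢 i → y ∈ 𝒢 j →
    ρ (𝔤.bracket x y) =
      (i + 1).negOnePow • (ρ x * ρ y - ((i + 1) * (j + 1)).negOnePow • (ρ y * ρ x))

/-- `T = ∑ Tᵢ`, a degree `0` element of `Hom(S(𝔥), 𝔤)`, is a homotopy `𝒪`-operator of weight `lam`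
on `𝔤` with respect to an action on `𝔥`. -/
structure IsHomotopyOOperator {K G H : Type*} [Field K] [AddCommGroup G] [Module K G]
    [AddCommGroup H] [Module K H] {𝒢 : ℤ → Submodule K G} {ℋ : ℤ → Submodule K H}
    {𝔤 : SGLA K 𝒢} {𝔥 : SGLA K ℋ} (A : Action 𝔤 𝔥) (lam : K)
    (T : ∀ n : ℕ, MultilinearMap K (fun _ : Fin n => H) G) : Prop where
  hasDegree : ∀ n, HasDegree ℋ 𝒢 (T n) 0
  isGradedSymm : ∀ n, IsGradedSymm ℋ (T n)
  identity : ∀ (p : ℕ) (d : Fin p → ℤ) (v : Fin p → H), (∀ a, v a ∈ ℋ (d a)) →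
    (∑ i : Fin p, ∑ j ∈ Ioi i, pairSign d i j •
        T (p - 2 + 1)
          (Fin.cons (α := fun _ => H) (lam • 𝔥.bracket (v i) (v j)) (omitTwo v i j)))
      + (∑ l : Fin p, ∑ σ ∈ shufflesOne p l, koszulSign d σ •
        T (p - l - 1 + 1)
          (Fin.cons (α := fun _ => H)
            (A.ρ (T l (block (v ∘ σ) 0 l (by omega))) (v (σ l)))
            (block (v ∘ σ) (l + 1) (p - l - 1) (by omega))))
    = (2⁻¹ : K) • ∑ i : Fin (p + 1), ∑ σ ∈ shuffles p i, koszulSign d σ •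
        𝔤.bracket (T i (block (v ∘ σ) 0 i (by omega)))
          (T (p - i) (block (v ∘ σ) i (p - i) (by omega)))

/-- An operator homotopy post-Lie algebra structure on a symmetric graded Lie algebra. The product
with `n + 1` arguments (written `ϑ_{n+1}` on paper) is `θ n`, for `n ≥ 0`. -/
structure IsOperatorHomotopyPostLie {K V : Type*} [Field K] [AddCommGroup V] [Module K V]
    {𝒱 : ℤ → Submodule K V} (L : SGLA K 𝒱)
    (θ : ∀ n : ℕ, MultilinearMap K (fun _ : Fin (n + 1) => V) V) : Prop where
  hasDegree : ∀ n, HasDegree 𝒱 𝒱 (θ n) 1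
  graded_symm : ∀ (n : ℕ) (d : Fin n → ℤ) (x : Fin n → V) (y : V), (∀ a, x a ∈ 𝒱 (d a)) →
    ∀ σ : Equiv.Perm (Fin n),
      θ n (Fin.snoc (α := fun _ => V) (x ∘ σ) y)
        = koszulSign d σ • θ n (Fin.snoc (α := fun _ => V) x y)
  graded_derivation : ∀ (n : ℕ) (d : Fin n → ℤ) (x : Fin n → V) (i j : ℤ) (y z : V),
    (∀ a, x a ∈ 𝒱 (d a)) → y ∈ 𝒱 i → z ∈ 𝒱 j →
      θ n (Fin.snoc (α := fun _ => V) x (L.bracket y z))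
        = ((∑ a, d a) + 1).negOnePow • L.bracket (θ n (Fin.snoc (α := fun _ => V) x y)) z
          + (((∑ a, d a) + 1) * (i + 1)).negOnePow •
              L.bracket y (θ n (Fin.snoc (α := fun _ => V) x z))
  identity : ∀ (n : ℕ) (d : Fin n → ℤ) (x : Fin n → V) (e : ℤ) (y : V),
    (∀ a, x a ∈ 𝒱 (d a)) → y ∈ 𝒱 e →
      (∑ i : Fin n, ∑ σ ∈ shufflesOne n i, koszulSign d σ •
        θ (n - i - 1 + 1)
          (Fin.cons (α := fun _ => V) (θ i (block (x ∘ σ) 0 (i + 1) (by omega)))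
            (Fin.snoc (α := fun _ => V) (block (x ∘ σ) (i + 1) (n - i - 1) (by omega)) y)))
      + (∑ j : Fin (n + 1), ∑ σ ∈ shuffles n j,
        (∑ a : Fin j, block (d ∘ σ) 0 j (by omega) a).negOnePow • koszulSign d σ •
        θ j
          (Fin.snoc (α := fun _ => V) (block (x ∘ σ) 0 j (by omega))
            (θ (n - j)
              (Fin.snoc (α := fun _ => V) (block (x ∘ σ) j (n - j) (by omega)) y))))
      = ∑ i : Fin n, ∑ j ∈ Ioi i, (-pairSign d i j) •
        θ (n - 2 + 1)
          (Fin.cons (α := fun _ => V) (L.bracket (x i) (x j))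
            (Fin.snoc (α := fun _ => V) (omitTwo x i j) y))

/-- A curved `L_∞`-algebra structure `{l_k}_{k ≥ 0}` on a graded vector space: an element
`l = ∑ l_k` of `Hom¹(S(V), V)` with `l ∘ l = 0` for the Nijenhuis-Richardson circle product
(`[l, l]_{NR} = 2 l ∘ l` in degree `1`). -/
structure IsCurvedLInfinity {K V : Type*} [Field K] [AddCommGroup V] [Module K V]
    (𝒱 : ℤ → Submodule K V) (l : ∀ n : ℕ, MultilinearMap K (fun _ : Fin n => V) V) : Prop where
  hasDegree : ∀ n, HasDegree 𝒱 𝒱 (l n) 1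
  isGradedSymm : ∀ n, IsGradedSymm 𝒱 (l n)
  identity : ∀ (n : ℕ) (d : Fin n → ℤ) (v : Fin n → V), (∀ a, v a ∈ 𝒱 (d a)) →
    ∑ j : Fin (n + 1), ∑ σ ∈ shuffles n j, koszulSign d σ •
      l (n - j + 1)
        (Fin.cons (α := fun _ => V) (l j (block (v ∘ σ) 0 j (by omega)))
          (block (v ∘ σ) j (n - j) (by omega))) = 0

/-- An `L_∞`-algebra is a curved `L_∞`-algebra with `l₀ = 0`. -/
structure IsLInfinity {K V : Type*} [Field K] [AddCommGroup V] [Module K V]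
    (𝒱 : ℤ → Submodule K V) (l : ∀ n : ℕ, MultilinearMap K (fun _ : Fin n => V) V) : Prop
    extends IsCurvedLInfinity 𝒱 l where
  curvature_eq_zero : l 0 = 0

/-- A curved `L_∞`-algebra homomorphism `{f_k}_{k ≥ 0}` from an `L_∞`-algebra `(V, {l_k})` to the
`L_∞`-algebra given by a symmetric graded Lie algebra (only `l₂'`, the bracket, is nonzero). -/
structure IsCurvedLInfinityHom {K V W : Type*} [Field K] [AddCommGroup V] [Module K V]
    [AddCommGroup W] [Module K W] (𝒱 : ℤ → Submodule K V) {𝒲 : ℤ → Submodule K W}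
    (l : ∀ n : ℕ, MultilinearMap K (fun _ : Fin n => V) V) (L' : SGLA K 𝒲)
    (f : ∀ n : ℕ, MultilinearMap K (fun _ : Fin n => V) W) : Prop where
  source : IsLInfinity 𝒱 l
  hasDegree : ∀ n, HasDegree 𝒱 𝒲 (f n) 0
  isGradedSymm : ∀ n, IsGradedSymm 𝒱 (f n)
  identity : ∀ (n : ℕ) (d : Fin n → ℤ) (v : Fin n → V), (∀ a, v a ∈ 𝒱 (d a)) →
    ∑ i ∈ Ioi (0 : Fin (n + 1)),
      ∑ σ ∈ shuffles n i, koszulSign d σ •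
        f (n - i + 1)
          (Fin.cons (α := fun _ => V) (l i (block (v ∘ σ) 0 i (by omega)))
            (block (v ∘ σ) i (n - i) (by omega)))
    = (2⁻¹ : K) • ∑ i : Fin (n + 1), ∑ σ ∈ shuffles n i, koszulSign d σ •
        L'.bracket (f i (block (v ∘ σ) 0 i (by omega)))
          (f (n - i) (block (v ∘ σ) i (n - i) (by omega)))

end Structures

section Constructions

/-- The products `ϑ_{n+1}(v₁, …, v_{n+1}) = ρ(Tₙ(v₁, …, vₙ)) v_{n+1}` induced by `T`. -/
noncomputable def inducedProduct {K G H : Type*} [Field K] [AddCommGroup G] [Module K G]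
    [AddCommGroup H] [Module K H] {𝒢 : ℤ → Submodule K G} {ℋ : ℤ → Submodule K H}
    {𝔤 : SGLA K 𝒢} {𝔥 : SGLA K ℋ} (A : Action 𝔤 𝔥)
    (T : ∀ n : ℕ, MultilinearMap K (fun _ : Fin n => H) G) (n : ℕ) :
    MultilinearMap K (fun _ : Fin (n + 1) => H) H :=
  MultilinearMap.uncurryRight (M := fun _ : Fin (n + 1) => H) (A.ρ.compMultilinearMap (T n))

theorem inducedProduct_snoc {K G H : Type*} [Field K] [AddCommGroup G] [Module K G]
    [AddCommGroup H] [Module K H] {𝒢 : ℤ → Submodule K G} {ℋ : ℤ → Submodule K H}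
    {𝔤 : SGLA K 𝒢} {𝔥 : SGLA K ℋ} (A : Action 𝔤 𝔥)
    (T : ∀ n : ℕ, MultilinearMap K (fun _ : Fin n => H) G) (n : ℕ) (v : Fin n → H) (w : H) :
    inducedProduct A T n (Fin.snoc (α := fun _ => H) v w) = A.ρ (T n v) w := by
  simp [inducedProduct]

/-- The linear map that multiplies the component of degree `i` by `c i`. -/
noncomputable def gradeScale {K V : Type*} [Field K] [AddCommGroup V] [Module K V]
    (𝒱 : ℤ → Submodule K V) [DirectSum.Decomposition 𝒱] (c : ℤ → K) : V →ₗ[K] V :=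
  (DirectSum.toModule K ℤ V fun i => c i • (𝒱 i).subtype) ∘ₗ
    (DirectSum.decomposeLinearEquiv 𝒱).toLinearMap

theorem gradeScale_of_mem {K V : Type*} [Field K] [AddCommGroup V] [Module K V]
    (𝒱 : ℤ → Submodule K V) [DirectSum.Decomposition 𝒱] (c : ℤ → K) {i : ℤ} {x : V}
    (hx : x ∈ 𝒱 i) : gradeScale 𝒱 c x = c i • x := by
  have h : DirectSum.decompose 𝒱 x = DirectSum.lof K ℤ (fun i => 𝒱 i) i ⟨x, hx⟩ :=
    DirectSum.decompose_of_mem 𝒱 hx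
  simp only [gradeScale, LinearMap.comp_apply, LinearEquiv.coe_coe,
    DirectSum.decomposeLinearEquiv_apply, h, DirectSum.toModule_lof]
  simp

/-- The bijection that makes `x ∘ moveLast i` equal to `(x₁, …, x̂ᵢ, …, xₙ₊₁, xᵢ)`. -/
def moveLast {n : ℕ} (i : Fin (n + 1)) : Equiv.Perm (Fin (n + 1)) :=
  finSuccEquivLast.trans (finSuccEquiv' i).symm

theorem comp_moveLast {V : Type*} {n : ℕ} (i : Fin (n + 1)) (x : Fin (n + 1) → V) :
    (fun a => x (moveLast i a)) = Fin.snoc (α := fun _ => V) (i.removeNth x) (x i) := by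
  funext a
  refine Fin.lastCases ?_ (fun a => ?_) a
  · simp [moveLast]
  · simp [moveLast, Fin.removeNth]

/-- The graded symmetrization `∑ᵢ (-1)^{xᵢ(x_{i+1}+⋯+x_{n+1})} θ(x₁, …, x̂ᵢ, …, x_{n+1}, xᵢ)` of a
product in its last argument, as a multilinear map; the Koszul sign is split off by treating the
even and the odd part of `xᵢ` separately, see `symmetrize_apply`. -/
noncomputable def symmetrize {K V : Type*} [Field K] [AddCommGroup V] [Module K V]
    (𝒱 : ℤ → Submodule K V) [DirectSum.Decomposition 𝒱] {n : ℕ}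
    (θ : MultilinearMap K (fun _ : Fin (n + 1) => V) V) :
    MultilinearMap K (fun _ : Fin (n + 1) => V) V :=
  ∑ i : Fin (n + 1),
    ((θ.domDomCongr (moveLast i)).compLinearMap (fun j =>
        if j = i then gradeScale 𝒱 (fun e => if Even e then 1 else 0) else LinearMap.id)
      + (θ.domDomCongr (moveLast i)).compLinearMap (fun j =>
        if j = i then gradeScale 𝒱 (fun e => if Even e then 0 else 1)
        else if i < j then gradeScale 𝒱 (fun e => ((e.negOnePow : ℤ) : K))
        else LinearMap.id))

theorem symmetrize_apply {K V : Type*} [Field K] [AddCommGroup V] [Module K V]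
    (𝒱 : ℤ → Submodule K V) [DirectSum.Decomposition 𝒱] {n : ℕ}
    (θ : MultilinearMap K (fun _ : Fin (n + 1) => V) V) (d : Fin (n + 1) → ℤ)
    (x : Fin (n + 1) → V) (hx : ∀ a, x a ∈ 𝒱 (d a)) :
    symmetrize 𝒱 θ x = ∑ i : Fin (n + 1), (d i * ∑ a ∈ Ioi i, d a).negOnePow •
      θ (Fin.snoc (α := fun _ => V) (i.removeNth x) (x i)) := by
  have key : ∀ (i : Fin (n + 1)) (y : Fin (n + 1) → V),
      θ.domDomCongr (moveLast i) y =
        θ (Fin.snoc (α := fun _ => V) (i.removeNth y) (y i)) := fun i y => by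
    rw [MultilinearMap.domDomCongr_apply, comp_moveLast]
  simp only [symmetrize, _root_.sum_apply, add_apply,
    MultilinearMap.compLinearMap_apply]
  refine Finset.sum_congr rfl fun i _ => ?_
  rw [← key i x]
  rcases Int.even_or_odd (d i) with he | ho
  · have h1 : (fun j => (if j = i then gradeScale 𝒱 (fun e => if Even e then (1 : K) else 0)
        else LinearMap.id) (x j)) = x := by
      funext j
      by_cases hj : j = i
      · subst hj
        simp [gradeScale_of_mem 𝒱 _ (hx j), he]
      · simp [hj]
    rw [h1, Int.negOnePow_even _ (he.mul_right _), one_smul, add_eq_left]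
    refine MultilinearMap.map_coord_zero _ i ?_
    simp [gradeScale_of_mem 𝒱 _ (hx i), he]
  · have hne : ¬ Even (d i) := Int.not_even_iff_odd.mpr ho
    have h2 : (fun j => (if j = i then gradeScale 𝒱 (fun e => if Even e then (0 : K) else 1)
        else if i < j then gradeScale 𝒱 (fun e => ((e.negOnePow : ℤ) : K))
        else LinearMap.id) (x j)) =
        fun j => (if i < j then (((d j).negOnePow : ℤ) : K) else 1) • x j := by
      funext j
      by_cases hj : j = i
      · subst hj
        simp [gradeScale_of_mem 𝒱 _ (hx j), hne]
      · by_cases hij : i < j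
        · simp [hj, hij, gradeScale_of_mem 𝒱 _ (hx j)]
        · simp [hj, hij]
    rw [h2, MultilinearMap.map_smul_univ, MultilinearMap.map_coord_zero (i := i), zero_add]
    · have h3 : (∏ j, if i < j then (((d j).negOnePow : ℤ) : K) else 1)
          = (((d i * ∑ a ∈ Ioi i, d a).negOnePow : ℤ) : K) := by
        have h4 : (d i * ∑ a ∈ Ioi i, d a).negOnePow = ∏ a ∈ Ioi i, (d a).negOnePow := by
          have h5 : (d i * ∑ a ∈ Ioi i, d a).negOnePow = (∑ a ∈ Ioi i, d a).negOnePow := by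
            rw [Int.negOnePow_eq_iff]
            obtain ⟨m, hm⟩ := ho
            rw [hm]
            exact ⟨m * ∑ a ∈ Ioi i, d a, by ring⟩
          rw [h5]
          induction Ioi i using Finset.induction_on with
          | empty => simp
          | insert a s ha ih => rw [sum_insert ha, prod_insert ha, Int.negOnePow_add, ih]
        rw [h4, ← Finset.prod_filter]
        push_cast
        refine Finset.prod_congr ?_ fun _ _ => rfl
        ext a
        simp
      rw [h3, Units.smul_def, Int.cast_smul_eq_zsmul]
    · simp [gradeScale_of_mem 𝒱 _ (hx i), hne]

/-- The bracket of a symmetric graded Lie algebra as a multilinear map `l₂`. -/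
noncomputable def bracketTwo {K V : Type*} [Field K] [AddCommGroup V] [Module K V]
    {𝒱 : ℤ → Submodule K V} (L : SGLA K 𝒱) : MultilinearMap K (fun _ : Fin 2 => V) V :=
  MultilinearMap.uncurryRight (M := fun _ : Fin 2 => V)
    (L.bracket.compMultilinearMap (MultilinearMap.ofSubsingleton K V V (0 : Fin 1) LinearMap.id))

theorem bracketTwo_apply {K V : Type*} [Field K] [AddCommGroup V] [Module K V]
    {𝒱 : ℤ → Submodule K V} (L : SGLA K 𝒱) (x : Fin 2 → V) :
    bracketTwo L x = L.bracket (x 0) (x 1) := by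
  rfl

/-- The operations `l_k` attached to an operator homotopy post-Lie algebra: `l₁ = ϑ₁`,
`l₂(x, y) = ϑ₂(x, y) + (-1)^{xy} ϑ₂(y, x) + [x, y]`, and for `k ≥ 3` the graded symmetrization of
`ϑ_k` in its last argument (which for `k = 1, 2` gives the part of `l_k` without the bracket). -/
noncomputable def subadjacent {K V : Type*} [Field K] [AddCommGroup V] [Module K V]
    {𝒱 : ℤ → Submodule K V} [DirectSum.Decomposition 𝒱] (L : SGLA K 𝒱)
    (θ : ∀ n : ℕ, MultilinearMap K (fun _ : Fin (n + 1) => V) V) :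
    ∀ n : ℕ, MultilinearMap K (fun _ : Fin n => V) V
  | 0 => 0
  | 1 => θ 0
  | 2 => symmetrize 𝒱 (θ 1) + bracketTwo L
  | n + 3 => symmetrize 𝒱 (θ (n + 2))

theorem subadjacent_two {K V : Type*} [Field K] [AddCommGroup V] [Module K V]
    {𝒱 : ℤ → Submodule K V} [DirectSum.Decomposition 𝒱] (L : SGLA K 𝒱)
    (θ : ∀ n : ℕ, MultilinearMap K (fun _ : Fin (n + 1) => V) V) {i j : ℤ} {x y : V}
    (hx : x ∈ 𝒱 i) (hy : y ∈ 𝒱 j) :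
    subadjacent L θ 2 ![x, y] =
      θ 1 ![x, y] + (i * j).negOnePow • θ 1 ![y, x] + L.bracket x y := by
  have h : symmetrize 𝒱 (θ 1) ![x, y] = θ 1 ![x, y] + (i * j).negOnePow • θ 1 ![y, x] := by
    rw [symmetrize_apply 𝒱 (θ 1) ![i, j] ![x, y] (by
      intro a
      fin_cases a
      · exact hx
      · exact hy)]
    have e0 : Fin.snoc (α := fun _ => V) ((0 : Fin 2).removeNth ![x, y]) x = ![y, x] := by
      funext a
      fin_cases a <;> rfl
    have e1 : Fin.snoc (α := fun _ => V) ((1 : Fin 2).removeNth ![x, y]) y = ![x, y] := by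
      funext a
      fin_cases a <;> rfl
    have i0 : Ioi (0 : Fin 2) = {1} := rfl
    have i1 : Ioi (1 : Fin 2) = ∅ := rfl
    refine (Fin.sum_univ_two _).trans ?_
    simp [e1, i0, i1]
    abel
  change symmetrize 𝒱 (θ 1) ![x, y] + L.bracket x y = _
  rw [h]

theorem subadjacent_add_three {K V : Type*} [Field K] [AddCommGroup V] [Module K V]
    {𝒱 : ℤ → Submodule K V} [DirectSum.Decomposition 𝒱] (L : SGLA K 𝒱)
    (θ : ∀ n : ℕ, MultilinearMap K (fun _ : Fin (n + 1) => V) V) (n : ℕ)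
    (d : Fin (n + 3) → ℤ) (x : Fin (n + 3) → V) (hx : ∀ a, x a ∈ 𝒱 (d a)) :
    subadjacent L θ (n + 3) x = ∑ i : Fin (n + 3), (d i * ∑ a ∈ Ioi i, d a).negOnePow •
      θ (n + 2) (Fin.snoc (α := fun _ => V) (i.removeNth x) (x i)) :=
  symmetrize_apply 𝒱 (θ (n + 2)) d x hx

end Constructions

end HomotopyO

/-! Write `t_S` for the value of `T` on the arguments indexed by a finite set `S`, taken in
increasing order, and `l_S` for the value of the subadjacent operations. Because shuffles correspond
to subsets, every identity becomes a sum over ordered set partitions whose blocks are filled in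
increasing order, and every Koszul sign becomes a product of cross signs between blocks
(`sum_shuffles`, `sum_shufflesOne`, `sum_pairSign`).

By construction `l_S` is the signed sum over `k ∈ S` of `ρ(t_{S∖k}) v_k`, plus `[v_i, v_j]` when `S
= {i, j}`. The left side of the weight `1` operator identity, regrouped by the set of indices
consumed by the inner operation, is therefore the signed sum of the terms `T(l_S, rest)`. So that
identity is already the homomorphism identity (`IsHomotopyOOperator.hom_identity_univ`), and no
Jacobi identity enters.

The collection `t` behaves like one even element, for which the action gives `½ ρ([t, t]) = -ρ(t)²`
(`sum_action_bracket`). Applying `ρ(·) y` to the operator identity and moving the square to the left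
yields the post-Lie identity.

For the `L_∞` identities (`IsHomotopyOOperator.sum_subadjacent_subadjacent`), expand the outer
operation in `l(l_S, rest)`. If `T(l_S, …)` acts on some `v_k`, the homomorphism identity on the
complement of `k` gives `-ρ(t)² v_k`. If `ρ(t)` acts on `l_S`, the action part of `l_S` gives
`+ρ(t)² v_k`, which cancels this, and the bracket part gives `ρ(t)[v_i, v_j]`. The last cancels
against the terms `[ρ(t) v_i, v_j]` of the outer bracket, since `ρ(t)` is a derivation; what remains
is `[[v_i, v_j], v_k]`, which vanishes by Jacobi (`sum_pairBracket_bracket`). Graded symmetry of the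
operations follows from the cocycle rule for Koszul signs (`koszulSign_mul`). -/

namespace HomotopyO
open Finset

/-! ### Koszul signs of words and of pairs of index sets -/

section Signs

variable {ι : Type*} [LinearOrder ι]

/-- The sign of exchanging `a` and `b`, if they stand in the wrong order in the word `a b`. -/
def swapSign (d : ι → ℤ) (a b : ι) : ℤˣ := if b < a then (d a * d b).negOnePow else 1

/-- The Koszul sign of sorting the concatenation of the words `A` and `B`. -/
def crossSign (d : ι → ℤ) (A B : Finset ι) : ℤˣ := ∏ a ∈ A, ∏ b ∈ B, swapSign d a b

/-- The Koszul sign of sorting a word. -/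
def wordSign (d : ι → ℤ) : List ι → ℤˣ
  | [] => 1
  | a :: L => (L.map (swapSign d a)).prod * wordSign d L

theorem wordSign_append (d : ι → ℤ) (L₁ L₂ : List ι) :
    wordSign d (L₁ ++ L₂) = wordSign d L₁ * wordSign d L₂ *
      (L₁.map fun a => (L₂.map (swapSign d a)).prod).prod := by
  induction L₁ with
  | nil => simp [wordSign]
  | cons a L ih =>
    simp only [List.cons_append, wordSign, ih, List.map_append, List.prod_append, List.map_cons,
      List.prod_cons]
    simp only [mul_assoc, mul_left_comm, mul_comm]

theorem wordSign_of_sortedLT (d : ι → ℤ) {L : List ι} (h : L.SortedLT) : wordSign d L = 1 := by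
  rw [List.sortedLT_iff_pairwise] at h
  induction L with
  | nil => rfl
  | cons a L ih =>
    rw [List.pairwise_cons] at h
    rw [wordSign, ih h.2, mul_one]
    refine List.prod_eq_one fun x hx => ?_
    obtain ⟨b, hb, rfl⟩ := List.mem_map.1 hx
    exact if_neg (h.1 b hb).not_gt

theorem prod_map_prod_map_sort (d : ι → ℤ) (A B : Finset ι) :
    (A.sort.map fun a => (B.sort.map (swapSign d a)).prod).prod = crossSign d A B := by
  simp only [crossSign]
  rw [← List.prod_toFinset _ (A.sort_nodup _), Finset.sort_toFinset]
  refine Finset.prod_congr rfl fun a _ => ?_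
  rw [← List.prod_toFinset _ (B.sort_nodup _), Finset.sort_toFinset]

theorem wordSign_sort_append_sort (d : ι → ℤ) (A B : Finset ι) :
    wordSign d (A.sort ++ B.sort) = crossSign d A B := by
  rw [wordSign_append, wordSign_of_sortedLT d A.sortedLT_sort,
    wordSign_of_sortedLT d B.sortedLT_sort, prod_map_prod_map_sort, one_mul, one_mul]

/-- Inversions are split by their first position: those starting at `0` give the head factor of
`wordSign`, the others belong to the tail. -/
theorem prod_inversions_eq_wordSign (d : ι → ℤ) {n : ℕ} (f : Fin n → ι) :
    ∏ p ∈ (univ : Finset (Fin n × Fin n)).filter (fun p => p.1 < p.2 ∧ f p.2 < f p.1),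
      (d (f p.1) * d (f p.2)).negOnePow = wordSign d (List.ofFn f) := by
  rw [Finset.prod_filter, Fintype.prod_prod_type]
  induction n with
  | zero => simp [wordSign]
  | succ n ih =>
    rw [List.ofFn_succ, wordSign, ← ih fun i => f i.succ, Fin.prod_univ_succ]
    congr 1
    · rw [Fin.prod_univ_succ, List.map_ofFn, List.prod_ofFn]
      simp [swapSign, Fin.succ_pos]
    · refine Finset.prod_congr rfl fun i _ => ?_
      rw [Fin.prod_univ_succ]
      simp

theorem koszulSign_eq_wordSign {n : ℕ} (d : Fin n → ℤ) (σ : Equiv.Perm (Fin n)) :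
    koszulSign d σ = wordSign d (List.ofFn σ) :=
  prod_inversions_eq_wordSign d σ

theorem crossSign_union_left (d : ι → ℤ) {A B : Finset ι} (h : Disjoint A B) (C : Finset ι) :
    crossSign d (A ∪ B) C = crossSign d A C * crossSign d B C :=
  Finset.prod_union h

theorem crossSign_union_right (d : ι → ℤ) (C : Finset ι) {A B : Finset ι} (h : Disjoint A B) :
    crossSign d C (A ∪ B) = crossSign d C A * crossSign d C B := by
  simp only [crossSign, Finset.prod_union h, Finset.prod_mul_distrib]

theorem negOnePow_sum (d : ι → ℤ) (A : Finset ι) :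
    (∑ a ∈ A, d a).negOnePow = ∏ a ∈ A, (d a).negOnePow := by
  induction A using Finset.induction_on with
  | empty => simp
  | insert a s ha ih => rw [sum_insert ha, prod_insert ha, Int.negOnePow_add, ih]

/-- Each pair `a ∈ A`, `b ∈ B` is out of order in exactly one of the words `a b` and `b a`.
Disjointness excludes `a = b`, where neither factor would contribute. -/
theorem crossSign_mul_crossSign (d : ι → ℤ) {A B : Finset ι} (h : Disjoint A B) :
    crossSign d A B * crossSign d B A = ((∑ a ∈ A, d a) * ∑ b ∈ B, d b).negOnePow := by
  rw [crossSign, crossSign, Finset.prod_comm (s := B), ← Finset.prod_mul_distrib, Finset.sum_mul,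
    negOnePow_sum (fun a => d a * ∑ b ∈ B, d b)]
  refine Finset.prod_congr rfl fun a ha => ?_
  rw [← Finset.prod_mul_distrib, Finset.mul_sum, negOnePow_sum (fun b => d a * d b)]
  refine Finset.prod_congr rfl fun b hb => ?_
  rcases lt_trichotomy a b with hab | rfl | hab
  · simp [swapSign, hab, hab.not_gt, mul_comm]
  · exact absurd hb (Finset.disjoint_left.1 h ha)
  · simp [swapSign, hab, hab.not_gt]

theorem crossSign_comm (d : ι → ℤ) {A B : Finset ι} (h : Disjoint A B) :
    crossSign d A B = ((∑ a ∈ A, d a) * ∑ b ∈ B, d b).negOnePow * crossSign d B A := by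
  rw [← crossSign_mul_crossSign d h, mul_assoc, Int.units_mul_self, mul_one]

theorem crossSign_map {κ : Type*} [LinearOrder κ] (d : ι → ℤ) (e : κ ↪o ι) (A B : Finset κ) :
    crossSign d (A.map e.toEmbedding) (B.map e.toEmbedding) = crossSign (d ∘ e) A B := by
  simp [crossSign, swapSign]

theorem sort_map_orderEmbedding {κ : Type*} [LinearOrder κ] (e : κ ↪o ι) (A : Finset κ) :
    (A.map e.toEmbedding).sort = A.sort.map e := by
  have hn : (A.sort.map e).Nodup := (A.sort_nodup _).map e.injective
  have h2 : (A.sort.map e).toFinset = A.map e.toEmbedding := by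
    ext x; simp
  rw [← h2, List.toFinset_sort _ hn, List.pairwise_map]
  simp

theorem ofFn_eq_sort {n : ℕ} {f : Fin n → ι} (hf : StrictMono f) {S : Finset ι}
    (h : ∀ x, x ∈ S ↔ ∃ i, f i = x) : List.ofFn f = S.sort := by
  have h2 : (List.ofFn f).toFinset = S := by
    ext x; simp [h]
  rw [← h2, eq_comm, List.toFinset_sort _ (List.nodup_ofFn.2 hf.injective)]
  exact List.pairwise_ofFn.2 fun i j hij => (hf hij).le

end Signs

/-! ### Shuffles as subsets -/

section Shuffles

/-- Phrasing monotonicity through lists lets the two segments be compared with sorted finsets,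
without reference to their lengths in the types. -/
theorem mem_shuffles_iff {n : ℕ} {i : ℕ} (hi : i ≤ n) {σ : Equiv.Perm (Fin n)} :
    σ ∈ shuffles n i ↔ (List.ofFn (block σ 0 i (by omega))).SortedLT ∧
      (List.ofFn (block σ i (n - i) (by omega))).SortedLT := by
  simp only [shuffles, mem_filter, mem_univ, true_and, List.sortedLT_ofFn_iff]
  refine and_congr ⟨fun h a b hab => h ?_ ?_ ?_, fun h a ha b hb hab => ?_⟩
    ⟨fun h a b hab => h ?_ ?_ ?_, fun h a ha b hb hab => ?_⟩
  · simp
  · simp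
  · simpa using hab
  · simpa [block] using @h ⟨a, ha⟩ ⟨b, hb⟩ hab
  · simp
  · simp
  · simpa using hab
  · simp only [Set.mem_ofPred_eq] at ha hb
    have := @h ⟨a - i, by omega⟩ ⟨b - i, by omega⟩ (by simp only [Fin.mk_lt_mk]; omega)
    simpa [block, Nat.add_sub_cancel' ha, Nat.add_sub_cancel' hb] using this

theorem mem_shufflesOne_iff {n : ℕ} {i : ℕ} (hi : i < n) {σ : Equiv.Perm (Fin n)} :
    σ ∈ shufflesOne n i ↔ (List.ofFn (block σ 0 i (by omega))).SortedLT ∧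
      (List.ofFn (block σ (i + 1) (n - i - 1) (by omega))).SortedLT := by
  simp only [shufflesOne, mem_filter, mem_univ, true_and, List.sortedLT_ofFn_iff]
  refine and_congr ⟨fun h a b hab => h ?_ ?_ ?_, fun h a ha b hb hab => ?_⟩
    ⟨fun h a b hab => h ?_ ?_ ?_, fun h a ha b hb hab => ?_⟩
  · simp
  · simp
  · simpa using hab
  · simpa [block] using @h ⟨a, ha⟩ ⟨b, hb⟩ hab
  · simp only [Set.mem_ofPred_eq]; omega
  · simp only [Set.mem_ofPred_eq]; omega
  · simpa using hab
  · simp only [Set.mem_ofPred_eq] at ha hb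
    have := @h ⟨a - (i + 1), by omega⟩ ⟨b - (i + 1), by omega⟩
      (by simp only [Fin.mk_lt_mk]; omega)
    simpa [block, Nat.add_sub_cancel' ha, Nat.add_sub_cancel' hb] using this

theorem ofFn_block {α : Type*} {n : ℕ} (f : Fin n → α) (s m : ℕ) (h : s + m ≤ n) :
    List.ofFn (block f s m h) = ((List.ofFn f).drop s).take m := by
  refine List.ext_getElem (by simp; omega) fun i h1 h2 => ?_
  simp [block]

theorem exists_perm_ofFn_eq {n : ℕ} {L : List (Fin n)} (hL : L.Nodup) (hn : L.length = n) :
    ∃ σ : Equiv.Perm (Fin n), List.ofFn σ = L := by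
  have hinj : Function.Injective fun a : Fin n => L[(a : ℕ)]'(by omega) := by
    intro a b hab
    exact Fin.ext ((hL.getElem_inj_iff).1 hab)
  refine ⟨Equiv.ofBijective _ (Finite.injective_iff_bijective.1 hinj), ?_⟩
  refine List.ext_getElem (by simp [hn]) fun i h1 h2 => ?_
  simp

theorem sort_toFinset_of_sortedLT {ι : Type*} [LinearOrder ι] {L : List ι} (h : L.SortedLT) :
    L.toFinset.sort = L := by
  rw [List.toFinset_sort _ h.nodup]
  exact h.pairwise.imp le_of_lt

variable {M : Type*} [AddCommGroup M]

/-- A sum over all shuffles is a sum over all subsets. -/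
theorem sum_shuffles {n : ℕ} (d : Fin n → ℤ) (F : List (Fin n) → List (Fin n) → M) :
    ∑ i : Fin (n + 1), ∑ σ ∈ shuffles n i, koszulSign d σ •
      F (List.ofFn (block σ 0 i (by omega))) (List.ofFn (block σ i (n - i) (by omega)))
    = ∑ S ∈ (univ : Finset (Fin n)).powerset,
        crossSign d S (univ \ S) • F S.sort (univ \ S).sort := by
  rw [Finset.sum_sigma']
  have key : ∀ (i : Fin (n + 1)) (σ : Equiv.Perm (Fin n)), σ ∈ shuffles n i →
      List.ofFn σ = (List.ofFn σ).take i ++ (List.ofFn σ).drop i ∧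
      List.ofFn (block σ 0 i (by omega)) = (List.ofFn σ).take i ∧
      List.ofFn (block σ i (n - i) (by omega)) = (List.ofFn σ).drop i ∧
      ((List.ofFn σ).take i).toFinset.sort = (List.ofFn σ).take i ∧
      (univ \ ((List.ofFn σ).take i).toFinset).sort = (List.ofFn σ).drop i := by
    intro i σ hσ
    obtain ⟨h1, h2⟩ := (mem_shuffles_iff (by omega)).1 hσ
    have e1 : List.ofFn (block σ 0 i (by omega)) = (List.ofFn σ).take i := by
      rw [ofFn_block]; simp
    have e2 : List.ofFn (block σ i (n - i) (by omega)) = (List.ofFn σ).drop i := by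
      rw [ofFn_block, List.take_of_length_le]; simp
    rw [e1] at h1
    rw [e2] at h2
    refine ⟨(List.take_append_drop _ _).symm, e1, e2, sort_toFinset_of_sortedLT h1, ?_⟩
    have hnd : (List.ofFn σ).Nodup := List.nodup_ofFn.2 σ.injective
    have hu : univ \ ((List.ofFn σ).take i).toFinset = ((List.ofFn σ).drop i).toFinset := by
      rw [← List.take_append_drop (i : ℕ) (List.ofFn σ)] at hnd
      have hdisj := List.disjoint_of_nodup_append hnd
      ext x
      have hx : x ∈ List.ofFn σ := (List.mem_ofFn' _ _).2 (σ.surjective x)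
      rw [← List.take_append_drop (i : ℕ) (List.ofFn σ), List.mem_append] at hx
      simp only [mem_sdiff, mem_univ, true_and, List.mem_toFinset]
      exact ⟨fun h => hx.resolve_left h, fun h h' => hdisj h' h⟩
    rw [hu, sort_toFinset_of_sortedLT h2]
  -- A shuffle corresponds to the set of values of its first block: the word of `σ` is that set
  -- sorted, followed by its complement sorted, and `i` is its cardinality.
  refine Finset.sum_bij (fun p _ => ((List.ofFn p.2).take p.1).toFinset) ?_ ?_ ?_ ?_
  · simp
  · rintro ⟨i, σ⟩ h ⟨i', σ'⟩ h' heq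
    simp only [mem_sigma, mem_univ, true_and] at h h' heq
    obtain ⟨a, -, -, b, c⟩ := key i σ h
    obtain ⟨a', -, -, b', c'⟩ := key i' σ' h'
    rw [heq, b'] at b
    rw [heq, c'] at c
    have hσ : σ = σ' := by
      refine Equiv.ext fun x => congrFun (List.ofFn_injective ?_) x
      rw [a, a', b, c]
    have hi : i = i' := by
      have := congrArg List.length b
      simp only [List.length_take, List.length_ofFn] at this
      omega
    subst hσ hi
    rfl
  · intro S _
    have hcard : S.card ≤ n := by simpa using S.card_le_univ
    obtain ⟨σ, hσ⟩ := exists_perm_ofFn_eq (L := S.sort ++ (univ \ S).sort)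
      (List.nodup_append.2 ⟨S.sort_nodup _, (univ \ S).sort_nodup _, by
        intro a ha b hb
        simp only [mem_sort, mem_sdiff, mem_univ, true_and] at ha hb
        rintro rfl
        exact hb ha⟩)
      (by simp [Finset.card_sdiff, hcard])
    refine ⟨⟨⟨S.card, by omega⟩, σ⟩, ?_, ?_⟩
    · simp only [mem_sigma, mem_univ, true_and]
      rw [mem_shuffles_iff hcard, ofFn_block, ofFn_block, hσ]
      constructor
      · rw [List.drop_zero, List.take_left' (by simp)]
        exact S.sortedLT_sort
      · rw [List.drop_left' (by simp), List.take_of_length_le (by simp [Finset.card_sdiff])]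
        exact (univ \ S).sortedLT_sort
    · simp only [hσ]
      rw [List.take_left' (by simp), Finset.sort_toFinset]
  · rintro ⟨i, σ⟩ h
    simp only [mem_sigma, mem_univ, true_and] at h
    obtain ⟨a, a1, a2, b, c⟩ := key i σ h
    rw [a1, a2, b, c, koszulSign_eq_wordSign, ← wordSign_sort_append_sort, b, c, ← a]

/-- A sum over all `(i, 1, n - i - 1)`-shuffles is a sum over all ways to single out one index
and to split the others into two subsets. -/
theorem sum_shufflesOne {n : ℕ} (d : Fin n → ℤ) (F : List (Fin n) → Fin n → List (Fin n) → M) :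
    ∑ i : Fin n, ∑ σ ∈ shufflesOne n i, koszulSign d σ •
      F (List.ofFn (block σ 0 i (by omega))) (σ i)
        (List.ofFn (block σ (i + 1) (n - i - 1) (by omega)))
    = ∑ k : Fin n, ∑ S ∈ (univ.erase k).powerset,
        (crossSign d S {k} * crossSign d (S ∪ {k}) (univ.erase k \ S)) •
          F S.sort k (univ.erase k \ S).sort := by
  rw [Finset.sum_sigma', Finset.sum_sigma']
  have key : ∀ (i : Fin n) (σ : Equiv.Perm (Fin n)), σ ∈ shufflesOne n i →
      List.ofFn σ = (List.ofFn σ).take i ++ σ i :: (List.ofFn σ).drop (i + 1) ∧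
      List.ofFn (block σ 0 i (by omega)) = (List.ofFn σ).take i ∧
      List.ofFn (block σ (i + 1) (n - i - 1) (by omega)) = (List.ofFn σ).drop (i + 1) ∧
      ((List.ofFn σ).take i).toFinset.sort = (List.ofFn σ).take i ∧
      (univ.erase (σ i) \ ((List.ofFn σ).take i).toFinset).sort = (List.ofFn σ).drop (i + 1) ∧
      σ i ∉ (List.ofFn σ).take i := by
    intro i σ hσ
    obtain ⟨h1, h2⟩ := (mem_shufflesOne_iff (by omega)).1 hσ
    have e0 : List.ofFn σ = (List.ofFn σ).take i ++ σ i :: (List.ofFn σ).drop (i + 1) := by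
      have : σ i = (List.ofFn σ)[(i : ℕ)]'(by simp) := by simp
      rw [this, List.getElem_cons_drop, List.take_append_drop]
    have e1 : List.ofFn (block σ 0 i (by omega)) = (List.ofFn σ).take i := by
      rw [ofFn_block]; simp
    have e2 : List.ofFn (block σ (i + 1) (n - i - 1) (by omega)) = (List.ofFn σ).drop (i + 1) := by
      rw [ofFn_block, List.take_of_length_le]; simp; omega
    rw [e1] at h1
    rw [e2] at h2
    have hnd : (List.ofFn σ).Nodup := List.nodup_ofFn.2 σ.injective
    rw [e0, List.nodup_append] at hnd
    obtain ⟨-, hnd1, hnd2⟩ := hnd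
    rw [List.nodup_cons] at hnd1
    refine ⟨e0, e1, e2, sort_toFinset_of_sortedLT h1, ?_, fun h => hnd2 _ h _ (by simp) rfl⟩
    have hu : univ.erase (σ i) \ ((List.ofFn σ).take i).toFinset
        = ((List.ofFn σ).drop (i + 1)).toFinset := by
      ext x
      have hx : x ∈ List.ofFn σ := (List.mem_ofFn' _ _).2 (σ.surjective x)
      rw [e0, List.mem_append, List.mem_cons] at hx
      simp only [mem_sdiff, mem_erase, mem_univ, and_true, List.mem_toFinset]
      constructor
      · rintro ⟨h, h'⟩
        tauto
      · intro h
        refine ⟨?_, fun h' => hnd2 _ h' _ (List.mem_cons_of_mem _ h) rfl⟩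
        rintro rfl
        exact hnd1.1 h
    rw [hu, sort_toFinset_of_sortedLT h2]
  -- The word of `σ` is a sorted list, one letter, and another sorted list, so it is determined by
  -- the middle letter and the set of letters before it.
  refine Finset.sum_bij (fun p _ => ⟨p.2 p.1, ((List.ofFn p.2).take p.1).toFinset⟩) ?_ ?_ ?_ ?_
  · rintro ⟨i, σ⟩ h
    simp only [mem_sigma, mem_univ, true_and] at h
    simp only [mem_sigma, mem_univ, true_and, mem_powerset]
    intro x hx
    rw [List.mem_toFinset] at hx
    rw [mem_erase]
    refine ⟨?_, mem_univ _⟩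
    rintro rfl
    exact (key i σ h).2.2.2.2.2 hx
  · rintro ⟨i, σ⟩ h ⟨i', σ'⟩ h' heq
    simp only [mem_sigma, mem_univ, true_and, Sigma.mk.injEq, heq_eq_eq] at h h' heq
    obtain ⟨heq0, heq⟩ := heq
    obtain ⟨a, -, -, b, c, -⟩ := key i σ h
    obtain ⟨a', -, -, b', c', -⟩ := key i' σ' h'
    rw [heq, b'] at b
    rw [heq, heq0, c'] at c
    have hσ : σ = σ' := by
      refine Equiv.ext fun x => congrFun (List.ofFn_injective ?_) x
      rw [a, a', b, c, heq0]
    have hi : i = i' := by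
      have := congrArg List.length b
      simp only [List.length_take, List.length_ofFn] at this
      omega
    subst hσ hi
    rfl
  · rintro ⟨k, S⟩ hS
    simp only [mem_sigma, mem_univ, true_and, mem_powerset] at hS
    have hkS : k ∉ S := fun h => by simpa using hS h
    have hcard : S.card < n := by
      have := Finset.card_le_card hS
      rw [Finset.card_erase_of_mem (mem_univ _), Finset.card_fin] at this
      have := k.pos
      omega
    have hcard' : (univ.erase k \ S).card = n - S.card - 1 := by
      rw [Finset.card_sdiff_of_subset hS, Finset.card_erase_of_mem (mem_univ _), Finset.card_fin]
      omega
    obtain ⟨σ, hσ⟩ := exists_perm_ofFn_eq (L := S.sort ++ k :: (univ.erase k \ S).sort)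
      (List.nodup_append.2 ⟨S.sort_nodup _, List.nodup_cons.2
          ⟨by simp, (univ.erase k \ S).sort_nodup _⟩, by
        intro a ha b hb
        simp only [mem_sort, List.mem_cons, mem_sdiff, mem_erase] at ha hb
        rintro rfl
        rcases hb with rfl | hb
        · exact hkS ha
        · exact hb.2 ha⟩)
      (by simp only [List.length_append, length_sort, List.length_cons, hcard']; omega)
    have hk : σ ⟨S.card, hcard⟩ = k := by
      have : σ ⟨S.card, hcard⟩ = (List.ofFn σ)[S.card]'(by simpa) := by simp
      rw [this]
      simp [hσ]
    refine ⟨⟨⟨S.card, hcard⟩, σ⟩, ?_, ?_⟩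
    · simp only [mem_sigma, mem_univ, true_and]
      rw [mem_shufflesOne_iff hcard, ofFn_block, ofFn_block, hσ]
      constructor
      · rw [List.drop_zero, List.take_left' (by simp)]
        exact S.sortedLT_sort
      · rw [← List.drop_drop, List.drop_left' (by simp), List.drop_one, List.tail_cons,
          List.take_of_length_le (by simp [hcard'])]
        exact (univ.erase k \ S).sortedLT_sort
    · simp only [hσ, hk]
      rw [List.take_left' (by simp), Finset.sort_toFinset]
  · rintro ⟨i, σ⟩ h
    simp only [mem_sigma, mem_univ, true_and] at h
    obtain ⟨a, a1, a2, b, c, hi⟩ := key i σ h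
    simp only
    rw [a1, a2, b, c, koszulSign_eq_wordSign]
    congr 1
    have hd : Disjoint ((List.ofFn σ).take i).toFinset {σ i} := by
      simpa using hi
    rw [crossSign_union_left d hd]
    -- Both outer blocks are sorted, so only the cross signs between the three blocks survive in the
    -- sign of the word.
    conv_lhs => rw [a, ← b, ← c]
    rw [wordSign_append, wordSign_of_sortedLT d (sortedLT_sort _), wordSign,
      wordSign_of_sortedLT d (sortedLT_sort _)]
    simp only [List.map_cons, List.prod_cons, one_mul, mul_one]
    rw [List.prod_map_mul, prod_map_prod_map_sort, ← List.prod_toFinset _ (Finset.sort_nodup _ _),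
      ← List.prod_toFinset _ (Finset.sort_nodup _ _), Finset.sort_toFinset, Finset.sort_toFinset]
    simp only [crossSign, prod_singleton]
    rw [mul_left_comm, mul_comm (∏ x ∈ _, swapSign d _ x)]

end Shuffles

/-! ### Reindexing sums over subsets -/

section Subsets

variable {ι : Type*} [LinearOrder ι] {M : Type*} [AddCommGroup M]

theorem sum_powerset_sdiff_comm (U : Finset ι) (f : Finset ι → Finset ι → M) :
    ∑ S ∈ U.powerset, f S (U \ S) = ∑ S ∈ U.powerset, f (U \ S) S := by
  refine Finset.sum_bij' (fun S _ => U \ S) (fun S _ => U \ S) ?_ ?_ ?_ ?_ ?_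
  · intro S _; simp
  · intro S _; simp
  · intro S hS; exact Finset.sdiff_sdiff_eq_self (mem_powerset.1 hS)
  · intro S hS; exact Finset.sdiff_sdiff_eq_self (mem_powerset.1 hS)
  · intro S hS; simp only [Finset.sdiff_sdiff_eq_self (mem_powerset.1 hS)]

/-- Both sides run over the ordered partitions of `U` into a set `S`, a single element `k` and a
remainder; only the order of the choices differs. -/
theorem sum_powerset_sum_sdiff (U : Finset ι) (f : ι → Finset ι → Finset ι → M) :
    ∑ S ∈ U.powerset, ∑ k ∈ U \ S, f k S ((U \ S).erase k)
      = ∑ k ∈ U, ∑ S ∈ (U.erase k).powerset, f k S (U.erase k \ S) := by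
  rw [Finset.sum_comm' (s' := fun k => (U.erase k).powerset) (t' := U)]
  · refine Finset.sum_congr rfl fun k _ => Finset.sum_congr rfl fun S _ => ?_
    rw [Finset.erase_sdiff_comm]
  · intro S k
    simp only [mem_powerset, mem_sdiff, Finset.subset_erase]
    tauto

theorem sum_powerset_sum_mem (U : Finset ι) (f : ι → Finset ι → Finset ι → M) :
    ∑ S ∈ U.powerset, ∑ k ∈ S, f k (S.erase k) (U \ S)
      = ∑ k ∈ U, ∑ S ∈ (U.erase k).powerset, f k S (U.erase k \ S) := by
  rw [sum_powerset_sdiff_comm U fun S C => ∑ k ∈ S, f k (S.erase k) C,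
    sum_powerset_sum_sdiff U fun k S B => f k B S]
  exact Finset.sum_congr rfl fun k _ => sum_powerset_sdiff_comm _ fun A B => f k B A

theorem sum_powerset_of_card_eq_two (U : Finset ι) (g : Finset ι → M)
    (hg : ∀ S, S.card ≠ 2 → g S = 0) :
    ∑ S ∈ U.powerset, g S = ∑ i ∈ U, ∑ j ∈ U with i < j, g {i, j} := by
  rw [← Finset.sum_filter_of_ne (p := fun S => S.card = 2)
    (fun S _ h => by_contra fun h' => h (hg S h')), Finset.sum_sigma']
  symm
  refine Finset.sum_bij (fun p _ => {p.1, p.2}) ?_ ?_ ?_ ?_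
  · rintro ⟨i, j⟩ h
    simp only [mem_sigma, mem_filter] at h
    simp only [mem_filter, mem_powerset]
    refine ⟨?_, Finset.card_pair h.2.2.ne⟩
    intro x hx
    rcases Finset.mem_insert.1 hx with rfl | hx
    · exact h.1
    · rw [Finset.mem_singleton.1 hx]
      exact h.2.1
  · rintro ⟨i, j⟩ h ⟨i', j'⟩ h' heq
    simp only [mem_sigma, mem_filter] at h h' heq
    have h1 : i ∈ ({i', j'} : Finset ι) := by rw [← heq]; simp
    have h2 : j ∈ ({i', j'} : Finset ι) := by rw [← heq]; simp
    simp only [mem_insert, mem_singleton] at h1 h2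
    have hlt := h.2.2
    have hlt' := h'.2.2
    rcases h1 with rfl | rfl <;> rcases h2 with rfl | rfl
    · exact absurd hlt (lt_irrefl _)
    · rfl
    · exact absurd hlt hlt'.not_gt
    · exact absurd hlt (lt_irrefl _)
  · intro S hS
    simp only [mem_filter, mem_powerset] at hS
    obtain ⟨hSU, hS⟩ := hS
    obtain ⟨x, y, hxy, rfl⟩ := Finset.card_eq_two.1 hS
    have hx : x ∈ U := hSU (by simp)
    have hy : y ∈ U := hSU (by simp)
    rcases lt_or_gt_of_ne hxy with h | h
    · exact ⟨⟨x, y⟩, by simp [hx, hy, h], rfl⟩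
    · exact ⟨⟨y, x⟩, by simp [hx, hy, h], Finset.pair_comm _ _⟩
  · intros; rfl

theorem sum_powerset_map {κ : Type*} [LinearOrder κ] (e : κ ↪o ι) (U : Finset κ)
    (f : Finset ι → Finset ι → M) :
    ∑ S ∈ (U.map e.toEmbedding).powerset, f S (U.map e.toEmbedding \ S)
      = ∑ S ∈ U.powerset, f (S.map e.toEmbedding) ((U \ S).map e.toEmbedding) := by
  symm
  refine Finset.sum_bij (fun S _ => S.map e.toEmbedding) ?_ ?_ ?_ ?_
  · intro S hS
    simpa using hS
  · intro S _ S' _ h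
    exact Finset.map_injective _ h
  · intro S hS
    obtain ⟨S', hS', rfl⟩ := Finset.subset_map_iff.1 (mem_powerset.1 hS)
    exact ⟨S', mem_powerset.2 hS', rfl⟩
  · intro S _
    rw [Finset.map_sdiff]

theorem sort_pair {i j : ι} (h : i < j) : ({i, j} : Finset ι).sort = [i, j] := by
  have hn : ([i, j] : List ι).Nodup := by simp [h.ne]
  have := (List.toFinset_sort (· ≤ ·) hn).2 (by simp [h.le])
  simpa using this

theorem crossSign_singleton_left (d : ι → ℤ) (k : ι) (B : Finset ι) :
    crossSign d {k} B = (d k * ∑ b ∈ B with b < k, d b).negOnePow := by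
  simp only [crossSign, prod_singleton, swapSign]
  rw [← Finset.prod_filter, Finset.mul_sum, negOnePow_sum (fun b => d k * d b)]

theorem crossSign_singleton_right (d : ι → ℤ) (A : Finset ι) (k : ι) :
    crossSign d A {k} = (d k * ∑ a ∈ A with k < a, d a).negOnePow := by
  simp only [crossSign, prod_singleton, swapSign]
  rw [← Finset.prod_filter, Finset.mul_sum, negOnePow_sum (fun b => d k * d b)]
  exact Finset.prod_congr rfl fun a _ => by rw [mul_comm]

theorem ofFn_orderEmbOfFin {S : Finset ι} {m : ℕ} (h : S.card = m) :
    List.ofFn (S.orderEmbOfFin h) = S.sort := by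
  refine ofFn_eq_sort (OrderEmbedding.strictMono _) fun x => ?_
  rw [← Finset.mem_coe, ← Finset.range_orderEmbOfFin S h, Set.mem_range]

theorem ofFn_orderEmbOfFin_succAbove {S : Finset ι} {m : ℕ} (h : S.card = m + 1)
    (i : Fin (m + 1)) :
    List.ofFn (fun a => S.orderEmbOfFin h (i.succAbove a))
      = (S.erase (S.orderEmbOfFin h i)).sort := by
  refine ofFn_eq_sort ((OrderEmbedding.strictMono _).comp (Fin.strictMono_succAbove i)) fun x => ?_
  rw [mem_erase, ← Finset.mem_coe, ← Finset.range_orderEmbOfFin S h, Set.mem_range]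
  constructor
  · rintro ⟨hne, a, rfl⟩
    obtain ⟨b, rfl⟩ := Fin.exists_succAbove_eq (x := a) (y := i) (fun h => hne (by rw [h]))
    exact ⟨b, rfl⟩
  · rintro ⟨b, rfl⟩
    exact ⟨fun h' => Fin.succAbove_ne i b ((S.orderEmbOfFin h).injective h'), _, rfl⟩

theorem sum_orderEmbOfFin {S : Finset ι} {m : ℕ} (h : S.card = m) (g : ι → M) :
    ∑ i, g (S.orderEmbOfFin h i) = ∑ k ∈ S, g k := by
  conv_rhs => rw [← Finset.map_orderEmbOfFin_univ S h]
  rw [Finset.sum_map]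
  rfl

/-- Translates the sign in `symmetrize`, which speaks of positions in a tuple, into the ambient
order: the positions after `i` are exactly the elements of `S` above the `i`-th one. -/
theorem negOnePow_orderEmbOfFin (d : ι → ℤ) {S : Finset ι} {m : ℕ} (h : S.card = m) (i : Fin m) :
    (d (S.orderEmbOfFin h i) * ∑ a ∈ Ioi i, d (S.orderEmbOfFin h a)).negOnePow
      = crossSign d (S.erase (S.orderEmbOfFin h i)) {S.orderEmbOfFin h i} := by
  rw [crossSign_singleton_right]
  congr 2
  have : Finset.filter (S.orderEmbOfFin h i < ·) (S.erase (S.orderEmbOfFin h i))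
      = (Ioi i).map (S.orderEmbOfFin h).toEmbedding := by
    ext x
    simp only [mem_filter, mem_erase, mem_map, mem_Ioi]
    constructor
    · rintro ⟨⟨-, hx⟩, hlt⟩
      rw [← Finset.mem_coe, ← Finset.range_orderEmbOfFin S h, Set.mem_range] at hx
      obtain ⟨a, rfl⟩ := hx
      exact ⟨a, by simpa using hlt, rfl⟩
    · rintro ⟨a, ha, rfl⟩
      have : S.orderEmbOfFin h i < S.orderEmbOfFin h a := by simpa using ha
      exact ⟨⟨this.ne', S.orderEmbOfFin_mem h a⟩, this⟩
  rw [this, Finset.sum_map]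
  rfl

end Subsets

/-! ### Sums over pairs of indices -/

section Pairs

/-- Both are the sign of pulling the letters `i < j` to the front of the word. -/
theorem pairSign_eq_crossSign {n : ℕ} (d : Fin n → ℤ) {i j : Fin n} (h : i < j) :
    pairSign d i j = crossSign d {i, j} (univ \ {i, j}) := by
  have hu : ({i, j} : Finset (Fin n)) = {i} ∪ {j} := rfl
  conv_rhs => arg 2; rw [hu]
  rw [crossSign_union_left d (by simpa using h.ne), crossSign_singleton_left,
    crossSign_singleton_left]
  have h1 : Finset.filter (· < i) (univ \ {i, j}) = Iio i := by
    ext x; simp only [mem_filter, mem_sdiff, mem_univ, true_and, mem_insert, mem_singleton, mem_Iio]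
    omega
  have h2 : Finset.filter (· < j) (univ \ {i, j}) = (Iio j).erase i := by
    ext x
    simp only [mem_filter, mem_sdiff, mem_univ, true_and, mem_insert, mem_singleton, mem_Iio,
      mem_erase]
    omega
  rw [h1, h2, ← Int.negOnePow_add, pairSign, ← Finset.add_sum_erase _ d (mem_Iio.2 h),
    Int.negOnePow_eq_iff]
  -- In `pairSign` the sum over indices below `j` includes `i`; that summand and the final `d i * d
  -- j` add up to an even number.
  exact ⟨d i * d j, by ring⟩

theorem ofFn_omitTwo {n : ℕ} {i j : Fin n} (h : i < j) :
    List.ofFn (omitTwo id i j) = (univ \ {i, j}).sort := by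
  refine ofFn_eq_sort ?_ fun x => ?_
  · intro a b hab
    simp only [omitTwo, id, Fin.mk_lt_mk]
    have : (a : ℕ) < b := hab
    split_ifs <;> omega
  · simp only [mem_sdiff, mem_univ, true_and, mem_insert, mem_singleton, omitTwo, id]
    have hj := j.isLt
    have hij : (i : ℕ) < j := h
    constructor
    · intro hx
      have hx1 : (x : ℕ) ≠ i := fun h => hx (Or.inl (Fin.ext h))
      have hx2 : (x : ℕ) ≠ j := fun h => hx (Or.inr (Fin.ext h))
      have := x.isLt
      -- The position of `x` after the omission is `x` minus the number of omitted indices below it.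
      refine ⟨⟨if (x : ℕ) < i then x else if (x : ℕ) < j then x - 1 else x - 2, ?_⟩, Fin.ext ?_⟩
      · split_ifs <;> omega
      · simp only
        split_ifs <;> omega
    · rintro ⟨a, rfl⟩
      have := a.isLt
      simp only [Fin.ext_iff]
      split_ifs <;> omega

/-- A sum over all pairs `i < j` is a sum over all subsets. -/
theorem sum_pairSign {M : Type*} [AddCommGroup M] {n : ℕ} (d : Fin n → ℤ)
    (F : List (Fin n) → List (Fin n) → M) (hF : ∀ L L', L.length ≠ 2 → F L L' = 0) :
    ∑ i : Fin n, ∑ j ∈ Ioi i, pairSign d i j • F [i, j] (List.ofFn (omitTwo id i j))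
      = ∑ S ∈ (univ : Finset (Fin n)).powerset,
        crossSign d S (univ \ S) • F S.sort (univ \ S).sort := by
  rw [sum_powerset_of_card_eq_two]
  · refine Finset.sum_congr rfl fun i _ => ?_
    have : Finset.filter (i < ·) univ = Ioi i := by ext; simp
    rw [this]
    refine Finset.sum_congr rfl fun j hj => ?_
    rw [mem_Ioi] at hj
    rw [pairSign_eq_crossSign d hj, ofFn_omitTwo hj, sort_pair hj]
  · intro S hS
    rw [hF _ _ (by simpa using hS), smul_zero]

end Pairs

/-! ### Multilinear maps evaluated on lists -/

section Lists

/-- The value of a sequence of multilinear maps on a list of arguments. -/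
def evalList {K V W : Type*} [Field K] [AddCommGroup V] [Module K V] [AddCommGroup W]
    [Module K W] (T : ∀ n : ℕ, MultilinearMap K (fun _ : Fin n => V) W) (L : List V) : W :=
  T L.length L.get

variable {K V W : Type*} [Field K] [AddCommGroup V] [Module K V] [AddCommGroup W] [Module K W]
  (T : ∀ n : ℕ, MultilinearMap K (fun _ : Fin n => V) W)

theorem evalList_ofFn {n : ℕ} (f : Fin n → V) : evalList T (List.ofFn f) = T n f := by
  -- The length of `List.ofFn f` is not literally `n`, so the equality is taken between pairs of an
  -- arity and a tuple, which avoids casts.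
  have h := List.equivSigmaTuple.apply_symm_apply (⟨n, f⟩ : Σ n, Fin n → V)
  exact congrArg (fun p : Σ n, Fin n → V => T p.1 p.2) h

theorem evalList_cons_ofFn {n : ℕ} (w : V) (f : Fin n → V) :
    evalList T (w :: List.ofFn f) = T (n + 1) (Fin.cons (α := fun _ => V) w f) := by
  rw [← evalList_ofFn, List.ofFn_succ]
  rfl

/-- Filling the first argument of a sequence of multilinear maps. -/
def evalListCons (L : List V) : V →ₗ[K] W where
  toFun w := evalList T (w :: L)
  map_add' x y := by
    have h := fun w => evalList_cons_ofFn T w L.get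
    simp only [List.ofFn_get] at h
    simp only [h, MultilinearMap.cons_add]
  map_smul' c x := by
    have h := fun w => evalList_cons_ofFn T w L.get
    simp only [List.ofFn_get] at h
    simp only [h, MultilinearMap.cons_smul, RingHom.id_apply]

theorem evalListCons_apply (w : V) (L : List V) :
    evalListCons T L w = evalList T (w :: L) := rfl

end Lists

/-! ### Subwords indexed by finite sets -/

section Words

/-- The entries of `v` with index in `S`, in increasing order. -/
def subword {ι α : Type*} [LinearOrder ι] (v : ι → α) (S : Finset ι) : List α := S.sort.map v

theorem subword_eq_ofFn {ι α : Type*} [LinearOrder ι] (v : ι → α) {S : Finset ι} {m : ℕ}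
    (h : S.card = m) : subword v S = List.ofFn fun i => v (S.orderEmbOfFin h i) := by
  rw [subword, ← ofFn_orderEmbOfFin h, List.map_ofFn]
  rfl

theorem subword_erase_eq_ofFn {ι α : Type*} [LinearOrder ι] (v : ι → α) {S : Finset ι} {m : ℕ}
    (h : S.card = m + 1) (i : Fin (m + 1)) :
    subword v (S.erase (S.orderEmbOfFin h i))
      = List.ofFn fun a => v (S.orderEmbOfFin h (i.succAbove a)) := by
  rw [subword, ← ofFn_orderEmbOfFin_succAbove h, List.map_ofFn]
  rfl

theorem subword_map {ι κ α : Type*} [LinearOrder ι] [LinearOrder κ] (v : ι → α) (e : κ ↪o ι)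
    (S : Finset κ) : subword v (S.map e.toEmbedding) = subword (v ∘ e) S := by
  rw [subword, sort_map_orderEmbedding, List.map_map]
  rfl

theorem subword_pair {ι α : Type*} [LinearOrder ι] (v : ι → α) {i j : ι} (h : i < j) :
    subword v {i, j} = [v i, v j] := by
  rw [subword, sort_pair h]
  rfl

theorem subword_singleton {ι α : Type*} [LinearOrder ι] (v : ι → α) (i : ι) :
    subword v {i} = [v i] := by
  simp [subword]

theorem length_subword {ι α : Type*} [LinearOrder ι] (v : ι → α) (S : Finset ι) :
    (subword v S).length = S.card := by
  simp [subword]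

theorem evalList_subword_mem {ι K V W : Type*} [LinearOrder ι] [Field K] [AddCommGroup V]
    [Module K V] [AddCommGroup W] [Module K W] {𝒱 : ℤ → Submodule K V} {𝒲 : ℤ → Submodule K W}
    {T : ∀ n : ℕ, MultilinearMap K (fun _ : Fin n => V) W} {e : ℤ}
    (hT : ∀ n, HasDegree 𝒱 𝒲 (T n) e) {d : ι → ℤ} {v : ι → V} (hv : ∀ a, v a ∈ 𝒱 (d a))
    (S : Finset ι) : evalList T (subword v S) ∈ 𝒲 ((∑ a ∈ S, d a) + e) := by
  rw [subword_eq_ofFn v rfl, evalList_ofFn]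
  have := hT S.card (fun i => d (S.orderEmbOfFin rfl i)) (fun i => v (S.orderEmbOfFin rfl i))
    fun i => hv _
  rwa [sum_orderEmbOfFin rfl d] at this

/-- The bracket of the two entries of a list of length two, and zero on all other lists. -/
def pairBracket {K V : Type*} [Field K] [AddCommGroup V] [Module K V] {𝒱 : ℤ → Submodule K V}
    (L : SGLA K 𝒱) : List V → V
  | [x, y] => L.bracket x y
  | _ => 0

theorem pairBracket_eq_zero {K V : Type*} [Field K] [AddCommGroup V] [Module K V]
    {𝒱 : ℤ → Submodule K V} (L : SGLA K 𝒱) {l : List V} (h : l.length ≠ 2) :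
    pairBracket L l = 0 := by
  match l with
  | [] => rfl
  | [_] => rfl
  | [_, _] => exact absurd rfl h
  | _ :: _ :: _ :: _ => rfl

theorem map_units_zsmul {K V W : Type*} [Field K] [AddCommGroup V] [Module K V] [AddCommGroup W]
    [Module K W] (f : V →ₗ[K] W) (u : ℤˣ) (x : V) : f (u • x) = u • f x := by
  rw [Units.smul_def, Units.smul_def, map_zsmul]

theorem units_zsmul_apply {K V W : Type*} [Field K] [AddCommGroup V] [Module K V] [AddCommGroup W]
    [Module K W] (f : V →ₗ[K] W) (u : ℤˣ) (x : V) : (u • f) x = u • f x := rfl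

end Words

/-! ### The operator identity and the operations `l_k` in terms of subsets -/

section Operator

variable {K G H : Type*} [Field K] [AddCommGroup G] [Module K G] [AddCommGroup H] [Module K H]
  {𝒢 : ℤ → Submodule K G} {ℋ : ℤ → Submodule K H} {𝔤 : SGLA K 𝒢} {𝔥 : SGLA K ℋ}
  {A : Action 𝔤 𝔥} {T : ∀ n : ℕ, MultilinearMap K (fun _ : Fin n => H) G}

theorem ofFn_block_comp {α : Type*} {n : ℕ} (v : Fin n → α) (σ : Equiv.Perm (Fin n)) (s m : ℕ)
    (h : s + m ≤ n) : List.ofFn (block (v ∘ σ) s m h) = (List.ofFn (block σ s m h)).map v := by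
  rw [List.map_ofFn]
  rfl

theorem sum_shuffles_bracket {n : ℕ} (d : Fin n → ℤ) (v : Fin n → H) :
    ∑ i : Fin (n + 1), ∑ σ ∈ shuffles n i, koszulSign d σ •
        𝔤.bracket (T i (block (v ∘ σ) 0 i (by omega)))
          (T (n - i) (block (v ∘ σ) i (n - i) (by omega)))
    = ∑ S ∈ (univ : Finset (Fin n)).powerset, crossSign d S (univ \ S) •
        𝔤.bracket (evalList T (subword v S)) (evalList T (subword v (univ \ S))) := by
  refine Eq.trans ?_ (sum_shuffles d fun L L' =>
    𝔤.bracket (evalList T (L.map v)) (evalList T (L'.map v)))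
  refine Finset.sum_congr rfl fun i _ => Finset.sum_congr rfl fun σ _ => ?_
  simp only [← ofFn_block_comp, evalList_ofFn]

/-- The defining identity of homotopy `𝒪`-operators, as a sum over subsets. -/
theorem IsHomotopyOOperator.identity_subsets {lam : K} (hT : IsHomotopyOOperator A lam T) {n : ℕ}
    (d : Fin n → ℤ) (v : Fin n → H) (hv : ∀ a, v a ∈ ℋ (d a)) :
    (∑ S ∈ (univ : Finset (Fin n)).powerset, crossSign d S (univ \ S) •
        evalList T ((lam • pairBracket 𝔥 (subword v S)) :: subword v (univ \ S)))
      + (∑ k : Fin n, ∑ S ∈ (univ.erase k).powerset,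
        (crossSign d S {k} * crossSign d (S ∪ {k}) (univ.erase k \ S)) •
          evalList T (A.ρ (evalList T (subword v S)) (v k) :: subword v (univ.erase k \ S)))
    = (2⁻¹ : K) • ∑ S ∈ (univ : Finset (Fin n)).powerset, crossSign d S (univ \ S) •
        𝔤.bracket (evalList T (subword v S)) (evalList T (subword v (univ \ S))) := by
  rw [← sum_shuffles_bracket, ← hT.identity n d v hv]
  congr 1
  · refine (sum_pairSign d (fun L L' => evalList T
      ((lam • pairBracket 𝔥 (L.map v)) :: L'.map v)) ?_).symm.trans ?_
    · intro L L' h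
      rw [pairBracket_eq_zero 𝔥 (by simpa using h), smul_zero, ← evalListCons_apply, map_zero]
    · refine Finset.sum_congr rfl fun i _ => Finset.sum_congr rfl fun j _ => ?_
      rw [List.map_ofFn, evalList_cons_ofFn]
      rfl
  · refine (sum_shufflesOne d fun L k L' =>
      evalList T (A.ρ (evalList T (L.map v)) (v k) :: L'.map v)).symm.trans ?_
    refine Finset.sum_congr rfl fun i _ => Finset.sum_congr rfl fun σ _ => ?_
    simp only [← ofFn_block_comp, evalList_ofFn, evalList_cons_ofFn]

/-- The action turns brackets of even elements `t` into squares: `½ ρ([t, t]) = - ρ(t)²`. -/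
theorem sum_action_bracket [CharZero K] {ι : Type*} [LinearOrder ι] (d : ι → ℤ)
    (t : Finset ι → G) (ht : ∀ S, t S ∈ 𝒢 (∑ a ∈ S, d a)) (U : Finset ι) (y : H) :
    A.ρ ((2⁻¹ : K) • ∑ S ∈ U.powerset, crossSign d S (U \ S) • 𝔤.bracket (t S) (t (U \ S))) y
    = -∑ S ∈ U.powerset, (crossSign d S (U \ S) * (∑ a ∈ S, d a).negOnePow) •
        A.ρ (t S) (A.ρ (t (U \ S)) y) := by
  -- The action rule turns each bracket into a graded commutator. Its two summands are exchanged by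
  -- `S ↦ U \ S`, so in total they give twice the same sum, and the factor `½` cancels.
  have h1 : ∀ S ∈ U.powerset,
      A.ρ (crossSign d S (U \ S) • 𝔤.bracket (t S) (t (U \ S))) y
      = -((crossSign d S (U \ S) * (∑ a ∈ S, d a).negOnePow) •
          A.ρ (t S) (A.ρ (t (U \ S)) y))
        - (crossSign d (U \ S) S * (∑ a ∈ U \ S, d a).negOnePow) •
          A.ρ (t (U \ S)) (A.ρ (t S) y) := by
    intro S _
    rw [map_units_zsmul, A.map_bracket _ _ _ _ (ht S) (ht (U \ S)),
      crossSign_comm d (disjoint_sdiff : Disjoint S (U \ S))]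
    simp only [LinearMap.sub_apply, units_zsmul_apply, Module.End.mul_apply, smul_sub, smul_smul]
    have e1 : (((∑ a ∈ S, d a) + 1).negOnePow : ℤˣ) = -(∑ a ∈ S, d a).negOnePow := by
      rw [Int.negOnePow_succ]
    have e2 : ((∑ a ∈ S, d a) * ∑ a ∈ U \ S, d a).negOnePow * crossSign d (U \ S) S *
        (((∑ a ∈ S, d a) + 1).negOnePow *
          (((∑ a ∈ S, d a) + 1) * ((∑ a ∈ U \ S, d a) + 1)).negOnePow)
        = crossSign d (U \ S) S * (∑ a ∈ U \ S, d a).negOnePow := by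
      rw [mul_comm _ (crossSign _ _ _), mul_assoc, ← Int.negOnePow_add, ← Int.negOnePow_add]
      congr 1
      rw [Int.negOnePow_eq_iff]
      exact ⟨(∑ a ∈ S, d a) * (∑ a ∈ U \ S, d a) + (∑ a ∈ S, d a) + 1, by ring⟩
    rw [e2, e1]
    simp only [mul_neg, Units.neg_smul]
  rw [map_smul, map_sum, LinearMap.smul_apply, LinearMap.sum_apply, Finset.sum_congr rfl h1,
    Finset.sum_sub_distrib, Finset.sum_neg_distrib,
    ← sum_powerset_sdiff_comm U fun S S' =>
      (crossSign d S S' * (∑ a ∈ S, d a).negOnePow) • A.ρ (t S) (A.ρ (t S') y),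
    ← neg_add', smul_neg, ← two_smul K, smul_smul, inv_mul_cancel₀ two_ne_zero, one_smul]

variable [DirectSum.Decomposition ℋ]

theorem removeNth_snoc_self {α : Type*} (x : Fin 1 → α) :
    Fin.snoc (α := fun _ => α) ((0 : Fin 1).removeNth x) (x 0) = x := by
  funext a
  fin_cases a
  rfl

/-- A uniform formula for the operations `l_k`. -/
theorem subadjacent_inducedProduct (n : ℕ) (d : Fin (n + 1) → ℤ) (x : Fin (n + 1) → H)
    (hx : ∀ a, x a ∈ ℋ (d a)) :
    subadjacent 𝔥 (inducedProduct A T) (n + 1) x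
      = (∑ i : Fin (n + 1), (d i * ∑ a ∈ Ioi i, d a).negOnePow •
          A.ρ (T n (i.removeNth x)) (x i)) + pairBracket 𝔥 (List.ofFn x) := by
  have h : symmetrize ℋ (inducedProduct A T n) x =
      ∑ i : Fin (n + 1), (d i * ∑ a ∈ Ioi i, d a).negOnePow •
          A.ρ (T n (i.removeNth x)) (x i) := by
    rw [symmetrize_apply ℋ _ d x hx]
    simp only [inducedProduct_snoc]
  -- `subadjacent` is defined by cases on the arity; `pairBracket` supplies the bracket in arity `2`
  -- and vanishes in all others. In arity `1` the symmetrization has a single term with trivial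
  -- sign.
  match n with
  | 0 =>
    change inducedProduct A T 0 x = _
    rw [pairBracket_eq_zero _ (by simp), add_zero, Fin.sum_univ_one]
    conv_lhs => rw [← removeNth_snoc_self x, inducedProduct_snoc]
    have : Ioi (0 : Fin 1) = ∅ := rfl
    simp
  | 1 =>
    rw [← h]
    change _ + 𝔥.bracket (x 0) (x 1) = _
    simp [pairBracket]
  | n + 2 =>
    rw [← h, pairBracket_eq_zero _ (by simp), add_zero]
    rfl

theorem evalList_subadjacent_subword {ι : Type*} [LinearOrder ι] {d : ι → ℤ} {v : ι → H}
    (hv : ∀ a, v a ∈ ℋ (d a)) (S : Finset ι) :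
    evalList (subadjacent 𝔥 (inducedProduct A T)) (subword v S)
      = (∑ k ∈ S, crossSign d (S.erase k) {k} •
          A.ρ (evalList T (subword v (S.erase k))) (v k)) + pairBracket 𝔥 (subword v S) := by
  obtain hc | ⟨m, hc⟩ : S.card = 0 ∨ ∃ m, S.card = m + 1 := by
    cases h : S.card <;> simp
  · obtain rfl := Finset.card_eq_zero.1 hc
    simp only [sum_empty, zero_add, subword, sort_empty, List.map_nil, pairBracket]
    rfl
  · rw [← sum_orderEmbOfFin hc, subword_eq_ofFn v hc, evalList_ofFn,
      subadjacent_inducedProduct m (fun i => d (S.orderEmbOfFin hc i)) _ fun a => hv _]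
    congr 1
    refine Finset.sum_congr rfl fun i _ => ?_
    rw [negOnePow_orderEmbOfFin, subword_erase_eq_ofFn, evalList_ofFn]
    rfl

/-- The extra argument `w` stands in front: moving it to the end costs the sign of passing all of
`S`, while moving some `v k` to the end never passes `w`. -/
theorem evalList_subadjacent_cons {ι : Type*} [LinearOrder ι] {d : ι → ℤ} {v : ι → H}
    (hv : ∀ a, v a ∈ ℋ (d a)) (S : Finset ι) {e : ℤ} {w : H} (hw : w ∈ ℋ e) :
    evalList (subadjacent 𝔥 (inducedProduct A T)) (w :: subword v S)
      = (e * ∑ a ∈ S, d a).negOnePow • A.ρ (evalList T (subword v S)) w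
        + (∑ k ∈ S, crossSign d (S.erase k) {k} •
          A.ρ (evalList T (w :: subword v (S.erase k))) (v k))
        + pairBracket 𝔥 (w :: subword v S) := by
  have hd : ∀ a, Fin.cons (α := fun _ => H) w (fun i => v (S.orderEmbOfFin rfl i)) a ∈
      ℋ (Fin.cons (α := fun _ => ℤ) e (fun i => d (S.orderEmbOfFin rfl i)) a) := by
    intro a
    refine Fin.cases hw (fun i => hv _) a
  rw [subword_eq_ofFn v rfl, evalList_cons_ofFn, subadjacent_inducedProduct _ _ _ hd,
    Fin.sum_univ_succ]
  have hofn : List.ofFn (Fin.cons (α := fun _ => H) w fun i => v (S.orderEmbOfFin rfl i))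
      = w :: List.ofFn fun i => v (S.orderEmbOfFin rfl i) := by
    rw [List.ofFn_succ]; rfl
  rw [hofn]
  congr 2
  · rw [Fin.Ioi_zero_eq_map, Finset.sum_map, evalList_ofFn]
    simp only [Fin.cons_zero, Fin.removeNth_zero, Fin.tail_cons]
    congr 3
    exact sum_orderEmbOfFin rfl d
  · obtain hc | ⟨m, hc⟩ : S.card = 0 ∨ ∃ m, S.card = m + 1 := by
      cases h : S.card <;> simp
    · obtain rfl := Finset.card_eq_zero.1 hc
      rfl
    · have key : ∀ (c : ℕ) (hc' : S.card = c) (hc : c = m + 1),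
        ∑ i : Fin c, ((Fin.cons (α := fun _ => ℤ) e (fun i => d (S.orderEmbOfFin hc' i))) i.succ *
            ∑ a ∈ Ioi i.succ, Fin.cons (α := fun _ => ℤ) e
              (fun i => d (S.orderEmbOfFin hc' i)) a).negOnePow •
          A.ρ (T c (i.succ.removeNth (Fin.cons (α := fun _ => H) w
            (fun i => v (S.orderEmbOfFin hc' i))))) (Fin.cons (α := fun _ => H) w
              (fun i => v (S.orderEmbOfFin hc' i)) i.succ)
        = ∑ k ∈ S, crossSign d (S.erase k) {k} •
            A.ρ (evalList T (w :: subword v (S.erase k))) (v k) := by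
        rintro c hc' rfl
        rw [← sum_orderEmbOfFin hc']
        refine Finset.sum_congr rfl fun i _ => ?_
        rw [← negOnePow_orderEmbOfFin, subword_erase_eq_ofFn, evalList_cons_ofFn,
          Fin.Ioi_succ, Finset.sum_map]
        simp only [Fin.cons_succ]
        congr 4
        funext a
        refine Fin.cases rfl (fun a => ?_) a
        simp [Fin.removeNth]
      exact key _ rfl hc

end Operator

/-! ### Homomorphism identity and higher Jacobi identities -/

section Subadjacent

variable {K G H : Type*} [Field K] [AddCommGroup G] [Module K G] [AddCommGroup H] [Module K H]
  {𝒢 : ℤ → Submodule K G} {ℋ : ℤ → Submodule K H} {𝔤 : SGLA K 𝒢} {𝔥 : SGLA K ℋ}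
  {A : Action 𝔤 𝔥} {T : ∀ n : ℕ, MultilinearMap K (fun _ : Fin n => H) G}

theorem units_smul_mem {V : Type*} [AddCommGroup V] [Module K V] (p : Submodule K V) (u : ℤˣ)
    {x : V} (h : x ∈ p) : u • x ∈ p := by
  rw [Units.smul_def]
  exact zsmul_mem h _

theorem pairBracket_ofFn_mem {n : ℕ} (d : Fin n → ℤ) (x : Fin n → H)
    (hx : ∀ a, x a ∈ ℋ (d a)) : pairBracket 𝔥 (List.ofFn x) ∈ ℋ ((∑ a, d a) + 1) := by
  by_cases hn : n = 2
  · subst hn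
    rw [Fin.sum_univ_two]
    exact 𝔥.bracket_mem _ _ _ _ (hx 0) (hx 1)
  · rw [pairBracket_eq_zero _ (by simpa using hn)]
    exact zero_mem _

theorem sum_erase_eq_sum_pairs {M ι : Type*} [AddCommGroup M] [LinearOrder ι] (U : Finset ι)
    (h : ι → ι → M) :
    ∑ k ∈ U, ∑ m ∈ U.erase k, h m k = ∑ i ∈ U, ∑ j ∈ U with i < j, (h i j + h j i) := by
  have h1 : ∀ k ∈ U, ∑ m ∈ U.erase k, h m k
      = (∑ m ∈ U with m < k, h m k) + ∑ m ∈ U with k < m, h m k := by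
    intro k hk
    rw [Finset.sum_filter, Finset.sum_filter, ← Finset.sum_add_distrib,
      ← Finset.add_sum_erase _ _ hk]
    simp only [lt_irrefl, if_false, add_zero, zero_add]
    refine Finset.sum_congr rfl fun m hm => ?_
    rcases lt_or_gt_of_ne (Finset.ne_of_mem_erase hm) with h | h
    · simp [h, h.not_gt]
    · simp [h, h.not_gt]
  rw [Finset.sum_congr rfl h1, Finset.sum_add_distrib]
  simp only [Finset.sum_add_distrib]
  congr 1
  simp only [Finset.sum_filter]
  rw [Finset.sum_comm]

theorem sum_powerset_of_card_eq_one {M ι : Type*} [AddCommGroup M] [LinearOrder ι] (U : Finset ι)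
    (g : Finset ι → M) (hg : ∀ S, S.card ≠ 1 → g S = 0) :
    ∑ S ∈ U.powerset, g S = ∑ k ∈ U, g {k} := by
  symm
  refine Finset.sum_bij_ne_zero (fun k _ _ => {k}) ?_ ?_ ?_ ?_
  · intro k hk _
    simpa using hk
  · intro k _ _ k' _ _ h
    simpa using h
  · intro S hS hne
    obtain ⟨k, rfl⟩ := Finset.card_eq_one.1 (by_contra fun h => hne (hg S h))
    exact ⟨k, by simpa using hS, hne, rfl⟩
  · intros; rfl

/-- The Jacobi identity in the symmetric form `∑ ± [[vᵢ, vⱼ], vₖ] = 0`. -/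
theorem sum_pairBracket_bracket {n : ℕ} (d : Fin n → ℤ) (v : Fin n → H)
    (hv : ∀ a, v a ∈ ℋ (d a)) :
    ∑ k, crossSign d (univ.erase k) {k} •
      𝔥.bracket (pairBracket 𝔥 (subword v (univ.erase k))) (v k) = 0 := by
  by_cases hn : n = 3
  · subst hn
    have e0 : (univ : Finset (Fin 3)).erase 0 = {1, 2} := by decide
    have e1 : (univ : Finset (Fin 3)).erase 1 = {0, 2} := by decide
    have e2 : (univ : Finset (Fin 3)).erase 2 = {0, 1} := by decide
    rw [Fin.sum_univ_three, e0, e1, e2, subword_pair v (by decide), subword_pair v (by decide),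
      subword_pair v (by decide)]
    have s0 : crossSign d {1, 2} {(0 : Fin 3)} = (d 1 * d 0 + d 2 * d 0).negOnePow := by
      simp [crossSign, swapSign, Int.negOnePow_add]
    have s1 : crossSign d {0, 2} {(1 : Fin 3)} = (d 2 * d 1).negOnePow := by
      simp [crossSign, swapSign]
    have s2 : crossSign d {0, 1} {(2 : Fin 3)} = 1 := by
      simp [crossSign, swapSign]
    rw [s0, s1, s2]
    simp only [pairBracket]
    -- Graded symmetry flips two of the outer brackets so that the Leibniz rule applies; everything
    -- is then expressed by `[[v₀, v₁], v₂]` and `[v₁, [v₀, v₂]]`, whose coefficients cancel.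
    have hJ := 𝔥.leibniz _ _ _ _ _ _ (hv 0) (hv 1) (hv 2)
    have h1 := 𝔥.graded_symm _ _ _ _ (𝔥.bracket_mem _ _ _ _ (hv 1) (hv 2)) (hv 0)
    have h2 := 𝔥.graded_symm _ _ _ _ (𝔥.bracket_mem _ _ _ _ (hv 0) (hv 2)) (hv 1)
    rw [h1, h2, hJ]
    simp only [smul_add, smul_smul, ← Int.negOnePow_add, ← add_assoc]
    have k1 : (d 1 * d 0 + d 2 * d 0 + (d 1 + d 2 + 1) * d 0 + d 0 + 1).negOnePow = -1 := by
      rw [← Int.negOnePow_one, Int.negOnePow_eq_iff]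
      exact ⟨d 1 * d 0 + d 2 * d 0 + d 0, by ring⟩
    have k2 : (d 1 * d 0 + d 2 * d 0 + (d 1 + d 2 + 1) * d 0 + (d 0 + 1) * (d 1 + 1)).negOnePow
        = -(d 2 * d 1 + (d 0 + d 2 + 1) * d 1).negOnePow := by
      rw [← Int.negOnePow_succ, Int.negOnePow_eq_iff]
      exact ⟨d 1 * d 0 + d 2 * d 0 + d 0 - d 2 * d 1, by ring⟩
    rw [k1, k2]
    simp only [Units.neg_smul, one_smul]
    abel
  · refine Finset.sum_eq_zero fun k _ => ?_
    rw [pairBracket_eq_zero, map_zero, LinearMap.zero_apply, smul_zero]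
    rw [length_subword, Finset.card_erase_of_mem (mem_univ _), Finset.card_fin]
    have := k.pos
    omega

variable [DirectSum.Decomposition ℋ]

theorem subadjacent_hasDegree (hT : ∀ n, HasDegree ℋ 𝒢 (T n) 0) (n : ℕ) :
    HasDegree ℋ ℋ (subadjacent 𝔥 (inducedProduct A T) n) 1 := by
  intro d x hx
  cases n with
  | zero => exact zero_mem _
  | succ n =>
    rw [subadjacent_inducedProduct n d x hx]
    refine add_mem (sum_mem fun i _ => units_smul_mem _ _ ?_) (pairBracket_ofFn_mem d x hx)
    have h := (A.isDerivation _ _ (hT n (i.removeNth d) (i.removeNth x) fun a => hx _)).map_mem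
      _ _ (hx i)
    rw [Fin.sum_univ_succAbove d i]
    convert h using 2
    simp only [Fin.removeNth]
    ring

/-- A choice of `S` and `k ∉ S` in the action sum is the set `S ∪ {k}` with a marked element.
Summing over the mark, together with the bracket term, reconstitutes the operation `l` on that set.
-/
theorem IsHomotopyOOperator.hom_identity_univ (hT : IsHomotopyOOperator A 1 T) {n : ℕ}
    (d : Fin n → ℤ) (v : Fin n → H) (hv : ∀ a, v a ∈ ℋ (d a)) :
    ∑ S ∈ (univ : Finset (Fin n)).powerset, crossSign d S (univ \ S) •
        evalList T (evalList (subadjacent 𝔥 (inducedProduct A T)) (subword v S)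
          :: subword v (univ \ S))
    = (2⁻¹ : K) • ∑ S ∈ (univ : Finset (Fin n)).powerset, crossSign d S (univ \ S) •
        𝔤.bracket (evalList T (subword v S)) (evalList T (subword v (univ \ S))) := by
  rw [← hT.identity_subsets d v hv, ← sum_powerset_sum_mem univ fun k S B =>
    (crossSign d S {k} * crossSign d (S ∪ {k}) B) •
      evalList T (A.ρ (evalList T (subword v S)) (v k) :: subword v B), ← Finset.sum_add_distrib]
  refine Finset.sum_congr rfl fun S _ => ?_
  simp only [one_smul, ← evalListCons_apply]
  rw [evalList_subadjacent_subword hv, map_add, smul_add, add_comm, map_sum, Finset.smul_sum]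
  congr 1
  refine Finset.sum_congr rfl fun k hk => ?_
  have : S.erase k ∪ {k} = S := by
    rw [union_comm, ← insert_eq, insert_erase hk]
  rw [this, map_units_zsmul, smul_smul, mul_comm]

/-- General index sets are needed because the Jacobi computation uses the identity on `univ.erase
k`. The increasing enumeration of `U` preserves all signs and subwords. -/
theorem IsHomotopyOOperator.hom_identity_subsets (hT : IsHomotopyOOperator A 1 T) {ι : Type*}
    [LinearOrder ι] (d : ι → ℤ) (v : ι → H) (hv : ∀ a, v a ∈ ℋ (d a)) (U : Finset ι) :
    ∑ S ∈ U.powerset, crossSign d S (U \ S) •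
        evalList T (evalList (subadjacent 𝔥 (inducedProduct A T)) (subword v S)
          :: subword v (U \ S))
    = (2⁻¹ : K) • ∑ S ∈ U.powerset, crossSign d S (U \ S) •
        𝔤.bracket (evalList T (subword v S)) (evalList T (subword v (U \ S))) := by
  have hU : univ.map (U.orderEmbOfFin rfl).toEmbedding = U := Finset.map_orderEmbOfFin_univ U rfl
  have h := hT.hom_identity_univ (d ∘ U.orderEmbOfFin rfl) (v ∘ U.orderEmbOfFin rfl)
    fun a => hv _
  have h1 := sum_powerset_map (U.orderEmbOfFin rfl) univ fun S B => crossSign d S B •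
        evalList T (evalList (subadjacent 𝔥 (inducedProduct A T)) (subword v S) :: subword v B)
  have h2 := sum_powerset_map (U.orderEmbOfFin rfl) univ fun S B => crossSign d S B •
        𝔤.bracket (evalList T (subword v S)) (evalList T (subword v B))
  rw [hU] at h1 h2
  rw [h1, h2]
  simpa only [crossSign_map, subword_map] using h

/-- The higher Jacobi identities of the subadjacent operations, as sums over subsets. -/
theorem IsHomotopyOOperator.sum_subadjacent_subadjacent [CharZero K]
    (hT : IsHomotopyOOperator A 1 T) {n : ℕ}
    (d : Fin n → ℤ) (v : Fin n → H) (hv : ∀ a, v a ∈ ℋ (d a)) :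
    ∑ S ∈ (univ : Finset (Fin n)).powerset, crossSign d S (univ \ S) •
        evalList (subadjacent 𝔥 (inducedProduct A T))
          (evalList (subadjacent 𝔥 (inducedProduct A T)) (subword v S)
            :: subword v (univ \ S)) = 0 := by
  set l : Finset (Fin n) → H :=
    fun S => evalList (subadjacent 𝔥 (inducedProduct A T)) (subword v S) with hl
  set t : Finset (Fin n) → G := fun S => evalList T (subword v S) with ht
  have hlmem : ∀ S, l S ∈ ℋ ((∑ a ∈ S, d a) + 1) := fun S =>
    evalList_subword_mem (subadjacent_hasDegree hT.hasDegree) hv S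
  have htmem : ∀ S, t S ∈ 𝒢 (∑ a ∈ S, d a) := fun S => by
    simpa using evalList_subword_mem hT.hasDegree hv S
  -- Four kinds of terms: `ρ(t)` on the action part of `l S`, `ρ(t)` on its bracket part, `T(l S,
  -- …)` acting on a remaining `v k`, and the outer bracket.
  have hexp : ∀ S ∈ (univ : Finset (Fin n)).powerset, crossSign d S (univ \ S) •
        evalList (subadjacent 𝔥 (inducedProduct A T)) (l S :: subword v (univ \ S))
      = (crossSign d (univ \ S) S * (∑ a ∈ univ \ S, d a).negOnePow) •
          A.ρ (t (univ \ S)) (∑ k ∈ S, crossSign d (S.erase k) {k} • A.ρ (t (S.erase k)) (v k))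
        + (crossSign d (univ \ S) S * (∑ a ∈ univ \ S, d a).negOnePow) •
          A.ρ (t (univ \ S)) (pairBracket 𝔥 (subword v S))
        + (∑ k ∈ univ \ S, (crossSign d S (insert k ((univ \ S).erase k)) *
            crossSign d ((univ \ S).erase k) {k}) •
          A.ρ (evalList T (l S :: subword v ((univ \ S).erase k))) (v k))
        + crossSign d S (univ \ S) • pairBracket 𝔥 (l S :: subword v (univ \ S)) := by
    intro S _
    rw [evalList_subadjacent_cons hv _ (hlmem S), smul_add, smul_add, smul_smul, ← smul_add,
      ← map_add, ← evalList_subadjacent_subword hv S, Finset.smul_sum]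
    congr 2
    · rw [crossSign_comm d (disjoint_sdiff : Disjoint S (univ \ S)), mul_comm _ (crossSign _ _ _),
        mul_assoc, ← Int.negOnePow_add]
      congr 2
      rw [Int.negOnePow_eq_iff]
      exact ⟨(∑ a ∈ S, d a) * ∑ a ∈ univ \ S, d a, by ring⟩
    · refine Finset.sum_congr rfl fun k hk => ?_
      rw [insert_erase hk, smul_smul]
  have hsign : ∀ (k : Fin n), ∀ S ∈ (univ.erase k).powerset,
      crossSign d S (insert k (univ.erase k \ S)) * crossSign d (univ.erase k \ S) {k}
      = crossSign d (univ.erase k) {k} * crossSign d S (univ.erase k \ S) := by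
    intro k S hS
    have hd : Disjoint ({k} : Finset (Fin n)) (univ.erase k \ S) := by simp
    have hu : S ∪ univ.erase k \ S = univ.erase k :=
      Finset.union_sdiff_of_subset (mem_powerset.1 hS)
    rw [insert_eq, crossSign_union_right d _ hd]
    conv_rhs => rw [← hu, crossSign_union_left d disjoint_sdiff, hu]
    simp only [mul_assoc, mul_comm]
  -- For fixed `k` the inner sum is the left side of the homomorphism identity on `univ.erase k`;
  -- under `ρ` its right side becomes minus a square.
  have ha : ∑ S ∈ (univ : Finset (Fin n)).powerset, ∑ k ∈ univ \ S,
        (crossSign d S (insert k ((univ \ S).erase k)) * crossSign d ((univ \ S).erase k) {k}) •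
          A.ρ (evalList T (l S :: subword v ((univ \ S).erase k))) (v k)
      = -∑ k, crossSign d (univ.erase k) {k} • ∑ S ∈ (univ.erase k).powerset,
          (crossSign d S (univ.erase k \ S) * (∑ a ∈ S, d a).negOnePow) •
            A.ρ (t S) (A.ρ (t (univ.erase k \ S)) (v k)) := by
    rw [sum_powerset_sum_sdiff univ fun k S B => (crossSign d S (insert k B) * crossSign d B {k}) •
          A.ρ (evalList T (l S :: subword v B)) (v k), ← Finset.sum_neg_distrib]
    refine Finset.sum_congr rfl fun k _ => ?_
    rw [← smul_neg, ← sum_action_bracket d t htmem, ← hT.hom_identity_subsets d v hv, map_sum,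
      LinearMap.sum_apply, Finset.smul_sum]
    refine Finset.sum_congr rfl fun S hS => ?_
    rw [hsign k S hS, map_units_zsmul, units_zsmul_apply, smul_smul]
  -- The same squares with the opposite sign, obtained by singling out the argument `v k` on which
  -- the inner action operates.
  have hb : ∑ S ∈ (univ : Finset (Fin n)).powerset,
        (crossSign d (univ \ S) S * (∑ a ∈ univ \ S, d a).negOnePow) •
          A.ρ (t (univ \ S)) (∑ k ∈ S, crossSign d (S.erase k) {k} • A.ρ (t (S.erase k)) (v k))
      = ∑ k, crossSign d (univ.erase k) {k} • ∑ S ∈ (univ.erase k).powerset,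
          (crossSign d S (univ.erase k \ S) * (∑ a ∈ S, d a).negOnePow) •
            A.ρ (t S) (A.ρ (t (univ.erase k \ S)) (v k)) := by
    rw [← sum_powerset_sdiff_comm univ fun S B =>
      (crossSign d S B * (∑ a ∈ S, d a).negOnePow) •
          A.ρ (t S) (∑ k ∈ B, crossSign d (B.erase k) {k} • A.ρ (t (B.erase k)) (v k))]
    have : ∀ S ∈ (univ : Finset (Fin n)).powerset,
        (crossSign d S (univ \ S) * (∑ a ∈ S, d a).negOnePow) •
          A.ρ (t S) (∑ k ∈ univ \ S, crossSign d ((univ \ S).erase k) {k} •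
            A.ρ (t ((univ \ S).erase k)) (v k))
        = ∑ k ∈ univ \ S, (crossSign d S (insert k ((univ \ S).erase k)) *
            crossSign d ((univ \ S).erase k) {k} * (∑ a ∈ S, d a).negOnePow) •
            A.ρ (t S) (A.ρ (t ((univ \ S).erase k)) (v k)) := by
      intro S _
      rw [map_sum, Finset.smul_sum]
      refine Finset.sum_congr rfl fun k hk => ?_
      rw [insert_erase hk, map_units_zsmul, smul_smul]
      congr 1
      simp only [mul_assoc, mul_comm]
    rw [Finset.sum_congr rfl this, sum_powerset_sum_sdiff univ fun k S B =>
      (crossSign d S (insert k B) * crossSign d B {k} * (∑ a ∈ S, d a).negOnePow) •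
        A.ρ (t S) (A.ρ (t B) (v k))]
    refine Finset.sum_congr rfl fun k _ => ?_
    rw [Finset.smul_sum]
    refine Finset.sum_congr rfl fun S hS => ?_
    rw [hsign k S hS, smul_smul, mul_assoc]
  -- The outer bracket is nonzero only when one argument is left over. Its iterated-bracket part
  -- vanishes by Jacobi, and the rest matches the derivation rule pair by pair.
  have hc : ∑ S ∈ (univ : Finset (Fin n)).powerset,
        crossSign d S (univ \ S) • pairBracket 𝔥 (l S :: subword v (univ \ S))
      = -∑ S ∈ (univ : Finset (Fin n)).powerset,
        (crossSign d (univ \ S) S * (∑ a ∈ univ \ S, d a).negOnePow) •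
          A.ρ (t (univ \ S)) (pairBracket 𝔥 (subword v S)) := by
    rw [sum_powerset_sdiff_comm univ fun S B =>
        crossSign d S B • pairBracket 𝔥 (l S :: subword v B),
      sum_powerset_of_card_eq_one, sum_powerset_of_card_eq_two, ← Finset.sum_neg_distrib]
    rotate_left
    · intro S hS
      rw [pairBracket_eq_zero _ (by simpa [length_subword] using hS), map_zero, smul_zero]
    · intro S hS
      rw [pairBracket_eq_zero _ (by simpa [length_subword] using hS), smul_zero]
    have h1 : ∀ k ∈ (univ : Finset (Fin n)),
        crossSign d (univ \ {k}) {k} • pairBracket 𝔥 (l (univ \ {k}) :: subword v {k})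
        = (∑ m ∈ univ.erase k, (crossSign d (univ.erase k) {k} *
            crossSign d ((univ.erase k).erase m) {m}) •
              𝔥.bracket (A.ρ (t ((univ.erase k).erase m)) (v m)) (v k))
          + crossSign d (univ.erase k) {k} •
            𝔥.bracket (pairBracket 𝔥 (subword v (univ.erase k))) (v k) := by
      intro k _
      rw [sdiff_singleton_eq_erase, subword_singleton]
      simp only [pairBracket, hl]
      rw [evalList_subadjacent_subword hv, map_add, LinearMap.add_apply, smul_add, map_sum,
        LinearMap.sum_apply, Finset.smul_sum]
      congr 1
      refine Finset.sum_congr rfl fun m _ => ?_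
      rw [map_units_zsmul, units_zsmul_apply, smul_smul]
    rw [Finset.sum_congr rfl h1, Finset.sum_add_distrib, sum_pairBracket_bracket d v hv, add_zero,
      sum_erase_eq_sum_pairs univ fun m k => (crossSign d (univ.erase k) {k} *
            crossSign d ((univ.erase k).erase m) {m}) •
              𝔥.bracket (A.ρ (t ((univ.erase k).erase m)) (v m)) (v k)]
    refine Finset.sum_congr rfl fun i _ => ?_
    rw [← Finset.sum_neg_distrib]
    refine Finset.sum_congr rfl fun j hj => ?_
    rw [mem_filter] at hj
    have hij := hj.2
    have hR : (univ.erase j).erase i = univ \ {i, j} := by ext x; simp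
    have hR' : (univ.erase i).erase j = univ \ {i, j} := by ext x; simp; tauto
    set R := univ \ {i, j} with hRdef
    have hj' : univ.erase j = R ∪ {i} := by ext x; simp [hRdef]; grind
    have hi' : univ.erase i = R ∪ {j} := by ext x; simp [hRdef]; grind
    have hdi : Disjoint R {i} := by simp [hRdef]
    have hdj : Disjoint R {j} := by simp [hRdef]
    have si : crossSign d {i} {j} = 1 := by simp [crossSign, swapSign, hij.not_gt]
    have sj : crossSign d {j} {i} = (d j * d i).negOnePow := by simp [crossSign, swapSign, hij]
    have spair : crossSign d R {i, j} = crossSign d R {i} * crossSign d R {j} := by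
      rw [insert_eq, crossSign_union_right d _ (by simpa using hij.ne)]
    rw [hR, hR', hj', hi', crossSign_union_left d hdi, crossSign_union_left d hdj, si, sj, spair,
      subword_pair v hij]
    simp only [pairBracket]
    have hder := A.isDerivation _ _ (htmem R)
    rw [hder.map_bracket _ _ _ _ (hv i) (hv j),
      -- The second Leibniz term is flipped so that the element acted upon comes first, as it does
      -- in the outer bracket.
      𝔥.graded_symm _ _ _ _ (hv i) (hder.map_mem _ _ (hv j)), smul_add, smul_smul, smul_smul,
      smul_smul, neg_add, ← Units.neg_smul, ← Units.neg_smul]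
    set s := ∑ a ∈ R, d a
    congr 2
    · rw [Int.negOnePow_succ]
      have : s.negOnePow * s.negOnePow = 1 := Int.units_mul_self _
      simp only [mul_one, mul_neg, neg_neg, mul_assoc, this]
      rw [mul_comm]
    · have : s.negOnePow * (((s + 1) * (d i + 1)).negOnePow * (d i * (d j + (s + 1))).negOnePow)
          = -(d j * d i).negOnePow := by
        rw [← Int.negOnePow_add, ← Int.negOnePow_add, ← Int.negOnePow_succ, Int.negOnePow_eq_iff]
        exact ⟨s + s * d i + d i, by ring⟩
      have h := congrArg Units.val this
      refine Units.ext ?_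
      simp only [Units.val_mul, Units.val_neg] at h ⊢
      linear_combination ((crossSign d R {i} : ℤ) * (crossSign d R {j} : ℤ)) * h
  rw [Finset.sum_congr rfl hexp, Finset.sum_add_distrib, Finset.sum_add_distrib,
    Finset.sum_add_distrib, ha, hb, hc]
  abel

end Subadjacent

/-! ### Koszul signs of composed permutations -/

section KoszulSign

theorem prod_lt_comp_perm {M : Type*} [CommMonoid M] {n : ℕ} (f : Fin n → Fin n → M)
    (hf : ∀ i j, f i j = f j i) (τ : Equiv.Perm (Fin n)) :
    ∏ p : Fin n × Fin n with p.1 < p.2, f (τ p.1) (τ p.2)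
      = ∏ p : Fin n × Fin n with p.1 < p.2, f p.1 p.2 := by
  refine Finset.prod_bij'
    (fun p _ => if τ p.1 < τ p.2 then (τ p.1, τ p.2) else (τ p.2, τ p.1))
    (fun p _ => if τ.symm p.1 < τ.symm p.2 then (τ.symm p.1, τ.symm p.2)
      else (τ.symm p.2, τ.symm p.1)) ?_ ?_ ?_ ?_ ?_
  · rintro ⟨i, j⟩ h
    simp only [mem_filter, mem_univ, true_and] at h ⊢
    have : τ i ≠ τ j := fun h' => h.ne (τ.injective h')
    split_ifs with h'
    · exact h'
    · exact lt_of_le_of_ne (not_lt.1 h') this.symm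
  · rintro ⟨i, j⟩ h
    simp only [mem_filter, mem_univ, true_and] at h ⊢
    have : τ.symm i ≠ τ.symm j := fun h' => h.ne (τ.symm.injective h')
    split_ifs with h'
    · exact h'
    · exact lt_of_le_of_ne (not_lt.1 h') this.symm
  · rintro ⟨i, j⟩ h
    simp only [mem_filter, mem_univ, true_and] at h ⊢
    split_ifs with h' <;> simp_all [h.not_gt]
  · rintro ⟨i, j⟩ h
    simp only [mem_filter, mem_univ, true_and] at h ⊢
    split_ifs with h' <;> simp_all [h.not_gt]
  · rintro ⟨i, j⟩ h
    simp only
    split_ifs with h'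
    · rfl
    · exact hf _ _

/-- The factor `g` of an unordered pair is symmetric, so the product for `σ` may be reindexed along
`τ`. A pair inverted by `τ` and then again by `σ` keeps its order in the composite, and its two
equal signs cancel. -/
theorem koszulSign_mul {n : ℕ} (d : Fin n → ℤ) (σ τ : Equiv.Perm (Fin n)) :
    koszulSign d (σ * τ) = koszulSign d σ * koszulSign (d ∘ σ) τ := by
  set g : Fin n → Fin n → ℤˣ := fun i j =>
    if (i < j ∧ σ j < σ i) ∨ (j < i ∧ σ i < σ j) then (d (σ i) * d (σ j)).negOnePow else 1 with hg
  have hK : ∀ (d : Fin n → ℤ) (σ : Equiv.Perm (Fin n)), koszulSign d σ =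
      ∏ p : Fin n × Fin n with p.1 < p.2,
        if σ p.2 < σ p.1 then (d (σ p.1) * d (σ p.2)).negOnePow else 1 := fun d σ => by
    rw [koszulSign, ← Finset.filter_filter, Finset.prod_filter]
  have h1 : koszulSign d σ = ∏ p : Fin n × Fin n with p.1 < p.2, g p.1 p.2 := by
    rw [hK]
    refine Finset.prod_congr rfl fun p hp => ?_
    rw [mem_filter] at hp
    simp [hg, hp.2, hp.2.not_gt]
  rw [h1, ← prod_lt_comp_perm g (fun i j => by simp only [hg, or_comm, mul_comm]) τ, hK, hK,
    ← Finset.prod_mul_distrib]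
  refine Finset.prod_congr rfl fun p hp => ?_
  rw [mem_filter] at hp
  simp only [hg, Equiv.Perm.mul_apply, Function.comp]
  rcases lt_or_gt_of_ne (fun h => hp.2.ne (τ.injective h) : τ p.1 ≠ τ p.2) with h | h
  · by_cases h' : σ (τ p.2) < σ (τ p.1) <;> simp [h, h.not_gt, h']
  · rcases lt_or_gt_of_ne (fun h' => h.ne' (σ.injective h') : σ (τ p.1) ≠ σ (τ p.2)) with h' | h'
    · simp [h, h.not_gt, h', h'.not_gt, Int.units_mul_self]
    · simp [h, h.not_gt, h', h'.not_gt]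

theorem koszulSign_one {n : ℕ} (d : Fin n → ℤ) : koszulSign d 1 = 1 := by
  rw [koszulSign, Finset.filter_false_of_mem, prod_empty]
  intro p _ h
  exact h.1.not_gt h.2

theorem koszulSign_moveLast {n : ℕ} (d : Fin (n + 1) → ℤ) (i : Fin (n + 1)) :
    koszulSign d (moveLast i) = (d i * ∑ a ∈ Ioi i, d a).negOnePow := by
  have h1 : List.ofFn (moveLast i) = (univ.erase i).sort ++ ({i} : Finset (Fin (n + 1))).sort := by
    have h := comp_moveLast i id
    simp only [id] at h
    rw [show (⇑(moveLast i) : Fin (n + 1) → Fin (n + 1)) = fun a => moveLast i a from rfl, h,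
      List.ofFn_succ', List.concat_eq_append, sort_singleton]
    simp only [Fin.snoc_castSucc, Fin.snoc_last]
    congr 1
    refine ofFn_eq_sort (Fin.strictMono_succAbove i) fun x => ?_
    rw [mem_erase]
    constructor
    · rintro ⟨hx, -⟩
      exact Fin.exists_succAbove_eq hx
    · rintro ⟨a, rfl⟩
      exact ⟨Fin.succAbove_ne i a, mem_univ _⟩
  rw [koszulSign_eq_wordSign, h1, wordSign_sort_append_sort, crossSign_singleton_right]
  congr 3
  ext x
  simp only [mem_filter, mem_erase, mem_univ, and_true, mem_Ioi, and_iff_right_iff_imp]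
  exact fun h => h.ne'

theorem exists_perm_of_map_last {n : ℕ} (τ : Equiv.Perm (Fin (n + 1)))
    (h : τ (Fin.last n) = Fin.last n) :
    ∃ τ' : Equiv.Perm (Fin n), ∀ a, τ a.castSucc = (τ' a).castSucc := by
  have hne : ∀ a : Fin n, τ a.castSucc ≠ Fin.last n := fun a h' =>
    (Fin.castSucc_lt_last a).ne (τ.injective (h'.trans h.symm))
  have hinj : Function.Injective fun a : Fin n => (τ a.castSucc).castPred (hne a) := by
    intro a b hab
    exact Fin.castSucc_injective _ (τ.injective (Fin.castPred_inj.1 hab))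
  exact ⟨Equiv.ofBijective _ (Finite.injective_iff_bijective.1 hinj), fun a => by simp⟩

theorem koszulSign_of_castSucc {n : ℕ} (d : Fin (n + 1) → ℤ) {τ : Equiv.Perm (Fin (n + 1))}
    {τ' : Equiv.Perm (Fin n)} (h : τ (Fin.last n) = Fin.last n)
    (h' : ∀ a, τ a.castSucc = (τ' a).castSucc) :
    koszulSign d τ = koszulSign (fun a => d a.castSucc) τ' := by
  rw [koszulSign, koszulSign, Finset.prod_filter, Finset.prod_filter, Fintype.prod_prod_type,
    Fintype.prod_prod_type, Fin.prod_univ_castSucc]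
  simp only [Fin.prod_univ_castSucc, h, h', Fin.castSucc_lt_castSucc_iff, (Fin.le_last _).not_gt,
    false_and, and_false, if_false, mul_one, Finset.prod_const_one]

end KoszulSign

/-! ### Graded symmetry of the symmetrized products -/

section GradedSymmetry

variable {K V : Type*} [Field K] [AddCommGroup V] [Module K V]
  {𝒱 : ℤ → Submodule K V}

/-- Symmetrizing in the last argument gives a graded symmetric map. -/
theorem sum_moveLast_comp_perm {W : Type*} [AddCommGroup W] {n : ℕ}
    (θ : (Fin (n + 1) → V) → W)
    (hθ : ∀ (d : Fin (n + 1) → ℤ) (x : Fin (n + 1) → V), (∀ a, x a ∈ 𝒱 (d a)) →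
      ∀ τ : Equiv.Perm (Fin (n + 1)), τ (Fin.last n) = Fin.last n →
        θ (x ∘ τ) = koszulSign d τ • θ x)
    (d : Fin (n + 1) → ℤ) (x : Fin (n + 1) → V) (hx : ∀ a, x a ∈ 𝒱 (d a))
    (σ : Equiv.Perm (Fin (n + 1))) :
    ∑ i, koszulSign (d ∘ σ) (moveLast i) • θ ((x ∘ σ) ∘ moveLast i)
      = koszulSign d σ • ∑ i, koszulSign d (moveLast i) • θ (x ∘ moveLast i) := by
  rw [Finset.smul_sum, ← Equiv.sum_comp σ fun i =>
    koszulSign d σ • koszulSign d (moveLast i) • θ (x ∘ moveLast i)]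
  refine Finset.sum_congr rfl fun i _ => ?_
  have hl : ∀ j : Fin (n + 1), moveLast j (Fin.last n) = j := fun j => by simp [moveLast]
  -- Both `σ * moveLast i` and `moveLast (σ i)` send the last position to `σ i`, so they differ by a
  -- permutation fixing the last position, to which `hθ` applies.
  set τ := (moveLast (σ i))⁻¹ * (σ * moveLast i) with hτ
  have hτl : τ (Fin.last n) = Fin.last n := by
    rw [hτ, Equiv.Perm.mul_apply, Equiv.Perm.inv_eq_iff_eq, Equiv.Perm.mul_apply, hl, hl]
  have hmul : σ * moveLast i = moveLast (σ i) * τ := by rw [hτ, mul_inv_cancel_left]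
  have h1 : koszulSign (d ∘ σ) (moveLast i) = koszulSign d σ *
      (koszulSign d (moveLast (σ i)) * koszulSign (d ∘ moveLast (σ i)) τ) := by
    rw [← koszulSign_mul, ← hmul, koszulSign_mul, ← mul_assoc, Int.units_mul_self, one_mul]
  have h2 : (x ∘ σ) ∘ moveLast i = (x ∘ moveLast (σ i)) ∘ τ := by
    have := congrArg (fun ρ : Equiv.Perm (Fin (n + 1)) => x ∘ ρ) hmul
    simpa only [Equiv.Perm.coe_mul, ← Function.comp_assoc] using this
  rw [h2, hθ (d ∘ moveLast (σ i)) (x ∘ moveLast (σ i)) (fun a => hx _) τ hτl, h1,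
    smul_smul, smul_smul, mul_assoc, mul_assoc,
    Int.units_mul_self, mul_one]

theorem pairBracket_ofFn_comp_perm {L : SGLA K 𝒱} {n : ℕ} (d : Fin n → ℤ) (x : Fin n → V)
    (hx : ∀ a, x a ∈ 𝒱 (d a)) (σ : Equiv.Perm (Fin n)) :
    pairBracket L (List.ofFn (x ∘ σ)) = koszulSign d σ • pairBracket L (List.ofFn x) := by
  by_cases hn : n = 2
  · subst hn
    have h : ∀ σ : Equiv.Perm (Fin 2), σ = 1 ∨ σ = Equiv.swap 0 1 := by decide
    rcases h σ with rfl | rfl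
    · rw [koszulSign_one, one_smul]
      rfl
    · have hs : koszulSign d (Equiv.swap 0 1) = (d 1 * d 0).negOnePow := by
        simp [koszulSign_eq_wordSign, wordSign, swapSign, List.ofFn_succ]
      rw [hs]
      exact L.graded_symm _ _ _ _ (hx 1) (hx 0)
  · rw [pairBracket_eq_zero _ (by simpa using hn), pairBracket_eq_zero _ (by simpa using hn),
      smul_zero]

end GradedSymmetry

/-! ### The three assertions of the theorem -/

section Main

variable {K G H : Type*} [Field K] [AddCommGroup G] [Module K G] [AddCommGroup H] [Module K H]
  {𝒢 : ℤ → Submodule K G} {ℋ : ℤ → Submodule K H} {𝔤 : SGLA K 𝒢} {𝔥 : SGLA K ℋ}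
  {A : Action 𝔤 𝔥} {T : ∀ n : ℕ, MultilinearMap K (fun _ : Fin n => H) G}

theorem subadjacent_isGradedSymm [DirectSum.Decomposition ℋ] (hT : ∀ n, IsGradedSymm ℋ (T n))
    (n : ℕ) : IsGradedSymm ℋ (subadjacent 𝔥 (inducedProduct A T) n) := by
  intro d x hx σ
  cases n with
  | zero =>
    change (0 : H) = koszulSign d σ • (0 : H)
    rw [smul_zero]
  | succ n =>
    have key : ∀ (d : Fin (n + 1) → ℤ) (x : Fin (n + 1) → H), (∀ a, x a ∈ ℋ (d a)) →
        subadjacent 𝔥 (inducedProduct A T) (n + 1) x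
          = (∑ i, koszulSign d (moveLast i) • (fun y : Fin (n + 1) → H =>
              A.ρ (T n fun a => y a.castSucc) (y (Fin.last n))) (x ∘ moveLast i))
            + pairBracket 𝔥 (List.ofFn x) := by
      intro d x hx
      rw [subadjacent_inducedProduct n d x hx]
      congr 1
      refine Finset.sum_congr rfl fun i _ => ?_
      have : x ∘ moveLast i = Fin.snoc (α := fun _ => H) (i.removeNth x) (x i) := comp_moveLast i x
      rw [koszulSign_moveLast, this]
      simp only [Fin.snoc_castSucc, Fin.snoc_last]
    rw [key d x hx, key (d ∘ σ) (x ∘ σ) fun a => hx _, smul_add,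
      pairBracket_ofFn_comp_perm d x hx]
    refine congrArg (· + _) (sum_moveLast_comp_perm (𝒱 := ℋ) (fun y : Fin (n + 1) → H =>
      A.ρ (T n fun a => y a.castSucc) (y (Fin.last n))) ?_ d x hx σ)
    intro d x hx τ hτ
    obtain ⟨τ', hτ'⟩ := exists_perm_of_map_last τ hτ
    rw [koszulSign_of_castSucc d hτ hτ']
    simp only [Function.comp, hτ, hτ']
    have := hT n (fun a => d a.castSucc) (fun a => x a.castSucc) (fun a => hx _) τ'
    simp only [Function.comp_def] at this
    rw [this, map_units_zsmul, units_zsmul_apply]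

theorem IsHomotopyOOperator.isLInfinity [CharZero K] [DirectSum.Decomposition ℋ]
    (hT : IsHomotopyOOperator A 1 T) :
    IsLInfinity ℋ (subadjacent 𝔥 (inducedProduct A T)) where
  hasDegree := subadjacent_hasDegree hT.hasDegree
  isGradedSymm := subadjacent_isGradedSymm hT.isGradedSymm
  curvature_eq_zero := rfl
  identity n d v hv := by
    rw [← hT.sum_subadjacent_subadjacent d v hv]
    refine Eq.trans ?_ (sum_shuffles d fun L L' => evalList (subadjacent 𝔥 (inducedProduct A T))
      (evalList (subadjacent 𝔥 (inducedProduct A T)) (L.map v) :: L'.map v))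
    refine Finset.sum_congr rfl fun i _ => Finset.sum_congr rfl fun σ _ => ?_
    simp only [← ofFn_block_comp, evalList_ofFn, evalList_cons_ofFn]

theorem IsHomotopyOOperator.isCurvedLInfinityHom [CharZero K] [DirectSum.Decomposition ℋ]
    (hT : IsHomotopyOOperator A 1 T) :
    IsCurvedLInfinityHom ℋ (subadjacent 𝔥 (inducedProduct A T)) 𝔤 T where
  source := hT.isLInfinity
  hasDegree := hT.hasDegree
  isGradedSymm := hT.isGradedSymm
  identity n d v hv := by
    rw [sum_shuffles_bracket, ← hT.hom_identity_subsets d v hv]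
    refine Eq.trans ?_ (sum_shuffles d fun L L' => evalList T
      (evalList (subadjacent 𝔥 (inducedProduct A T)) (L.map v) :: L'.map v))
    simp only [← ofFn_block_comp, evalList_ofFn, evalList_cons_ofFn]
    -- The homomorphism identity starts at `i = 1`, while the subset sum also contains the empty
    -- set; that extra term vanishes because `l₀ = 0`.
    refine Finset.sum_subset (Finset.subset_univ _) fun i _ hi => Finset.sum_eq_zero fun σ _ => ?_
    have hi0 : i = 0 := by
      rw [mem_Ioi, not_lt] at hi
      exact Fin.le_zero_iff.1 hi
    subst hi0
    have h0 : ∀ x : Fin 0 → H, subadjacent 𝔥 (inducedProduct A T) 0 x = 0 := fun _ => rfl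
    have hx := h0 (block (v ∘ σ) 0 0 (by omega))
    refine (congrArg (koszulSign d σ • ·) ((T _).map_coord_zero 0 ?_)).trans (smul_zero _)
    exact hx

theorem inducedProduct_apply (n : ℕ) (x : Fin (n + 1) → H) :
    inducedProduct A T n x = A.ρ (T n (Fin.init x)) (x (Fin.last n)) := by
  rw [← inducedProduct_snoc, Fin.snoc_init_self]

theorem inducedProduct_hasDegree (hT : ∀ n, HasDegree ℋ 𝒢 (T n) 0) (n : ℕ) :
    HasDegree ℋ ℋ (inducedProduct A T n) 1 := by
  intro d x hx
  rw [inducedProduct_apply, Fin.sum_univ_castSucc]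
  have h := (A.isDerivation _ _ (hT n (Fin.init d) (Fin.init x) fun a => hx _)).map_mem
    _ _ (hx (Fin.last n))
  convert h using 2
  simp only [Fin.init]
  ring

theorem IsHomotopyOOperator.isOperatorHomotopyPostLie [CharZero K]
    (hT : IsHomotopyOOperator A 1 T) : IsOperatorHomotopyPostLie 𝔥 (inducedProduct A T) where
  hasDegree := inducedProduct_hasDegree hT.hasDegree
  graded_symm n d x y hx σ := by
    rw [inducedProduct_snoc, inducedProduct_snoc, hT.isGradedSymm n d x hx, map_units_zsmul,
      units_zsmul_apply]
  graded_derivation n d x i j y z hx hy hz := by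
    simp only [inducedProduct_snoc]
    have hd := hT.hasDegree n d x hx
    rw [add_zero] at hd
    exact (A.isDerivation _ _ hd).map_bracket _ _ _ _ hy hz
  identity n d x e y hx hy := by
    -- Applying `ρ(·) y` to the operator identity gives the post-Lie identity: the sums on its left
    -- become the first sum `h1` and minus the bracket sum `h3`, and the quadratic side becomes
    -- minus the nested sum `h2`.
    have hO := congrArg (fun g => A.ρ g y) (hT.identity n d x hx)
    simp only [sum_shuffles_bracket] at hO
    rw [sum_action_bracket d (fun S => evalList T (subword x S))
      (fun S => by simpa using evalList_subword_mem hT.hasDegree hx S), map_add,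
      LinearMap.add_apply] at hO
    have h2 : ∑ j : Fin (n + 1), ∑ σ ∈ shuffles n j,
        (∑ a : Fin j, block (d ∘ σ) 0 j (by omega) a).negOnePow • koszulSign d σ •
        inducedProduct A T j
          (Fin.snoc (α := fun _ => H) (block (x ∘ σ) 0 j (by omega))
            (inducedProduct A T (n - j)
              (Fin.snoc (α := fun _ => H) (block (x ∘ σ) j (n - j) (by omega)) y)))
        = ∑ S ∈ (univ : Finset (Fin n)).powerset,
          (crossSign d S (univ \ S) * (∑ a ∈ S, d a).negOnePow) •
            A.ρ (evalList T (subword x S)) (A.ρ (evalList T (subword x (univ \ S))) y) := by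
      refine Eq.trans ?_ ((sum_shuffles d fun L L' => (L.map d).sum.negOnePow •
        A.ρ (evalList T (L.map x)) (A.ρ (evalList T (L'.map x)) y)).trans ?_)
      · refine Finset.sum_congr rfl fun i _ => Finset.sum_congr rfl fun σ _ => ?_
        simp only [← ofFn_block_comp, evalList_ofFn, inducedProduct_snoc, List.sum_ofFn]
        rw [smul_comm]
      · refine Finset.sum_congr rfl fun S _ => ?_
        rw [smul_smul, ← List.sum_toFinset d (S.sort_nodup _), Finset.sort_toFinset]
        rfl
    have h1 : ∑ i : Fin n, ∑ σ ∈ shufflesOne n i, koszulSign d σ •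
        inducedProduct A T (n - i - 1 + 1)
          (Fin.cons (α := fun _ => H) (inducedProduct A T i (block (x ∘ σ) 0 (i + 1) (by omega)))
            (Fin.snoc (α := fun _ => H) (block (x ∘ σ) (i + 1) (n - i - 1) (by omega)) y))
        = A.ρ (∑ l : Fin n, ∑ σ ∈ shufflesOne n l, koszulSign d σ •
        T (n - l - 1 + 1)
          (Fin.cons (α := fun _ => H)
            (A.ρ (T l (block (x ∘ σ) 0 l (by omega))) (x (σ l)))
            (block (x ∘ σ) (l + 1) (n - l - 1) (by omega)))) y := by
      simp only [map_sum, LinearMap.sum_apply, map_units_zsmul, units_zsmul_apply]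
      refine Finset.sum_congr rfl fun i _ => Finset.sum_congr rfl fun σ _ => ?_
      rw [Fin.cons_snoc_eq_snoc_cons, inducedProduct_snoc, inducedProduct_apply]
      congr 6
      simp [block]
    have h3 : ∑ i : Fin n, ∑ j ∈ Ioi i, (-pairSign d i j) •
        inducedProduct A T (n - 2 + 1)
          (Fin.cons (α := fun _ => H) (𝔥.bracket (x i) (x j))
            (Fin.snoc (α := fun _ => H) (omitTwo x i j) y))
        = -A.ρ (∑ i : Fin n, ∑ j ∈ Ioi i, pairSign d i j •
        T (n - 2 + 1)
          (Fin.cons (α := fun _ => H) ((1 : K) • 𝔥.bracket (x i) (x j)) (omitTwo x i j))) y := by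
      simp only [map_sum, LinearMap.sum_apply, map_units_zsmul, units_zsmul_apply, one_smul,
        ← Finset.sum_neg_distrib, Units.neg_smul, Fin.cons_snoc_eq_snoc_cons, inducedProduct_snoc]
    rw [h1, h2, h3, ← neg_eq_iff_eq_neg.2 hO]
    abel

end Main
end HomotopyO

theorem mainTheorem8 {K G H : Type*} [Field K] [CharZero K]
    [AddCommGroup G] [Module K G] [AddCommGroup H] [Module K H]
    (𝒢 : ℤ → Submodule K G) [DirectSum.Decomposition 𝒢]
    (ℋ : ℤ → Submodule K H) [DirectSum.Decomposition ℋ]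
    (𝔤 : HomotopyO.SGLA K 𝒢) (𝔥 : HomotopyO.SGLA K ℋ) (A : HomotopyO.Action 𝔤 𝔥)
    (T : ∀ n : ℕ, MultilinearMap K (fun _ : Fin n => H) G)
    (hT : HomotopyO.IsHomotopyOOperator A 1 T) :
    HomotopyO.IsOperatorHomotopyPostLie 𝔥 (HomotopyO.inducedProduct A T) ∧
    HomotopyO.IsCurvedLInfinityHom ℋ
      (HomotopyO.subadjacent 𝔥 (HomotopyO.inducedProduct A T)) 𝔤 T :=
  ⟨hT.isOperatorHomotopyPostLie, hT.isCurvedLInfinityHom⟩
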